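/- For every integer $N\ge 0$, the function $t\mapsto t^{2N}\left|\Gamma\left(\tfrac12+it\right)\zeta\left(\tfrac12+it\right)\right|^2$ is integrable on $\mathbb{R}$ and $$\frac{(-4)^N}{2\pi}\int_{-\infty}^{\infty} t^{2N}\left|\Gamma\left(\tfrac12+it\right)\zeta\left(\tfrac12+it\right)\right|^2dt=\log(2\pi)-\gamma-4N+\left(\frac{4^N}{2}-1\right)B_{2N}+\sum_{j=2}^{2N}T_{2N,j}\,\frac{\zeta(j)B_j}{j},$$ where for integers $M\ge 0$ and $j\ge 2$ $$T_{M,j}=(j-1)!\sum_{n=2}^{M}\binom{M}{n}2^n\left[(-1)^nS(n+1,j)+(-1)^jS(n,j-1)\right].$$ Here $\Gamma$ is the Gamma function, $\zeta$ is the Riemann zeta function (meromorphically continued), $\gamma$ is Euler's constant, $B_j$ are the Bernoulli numbers defined by $\frac{x}{e^x-1}=\sum_{j\ge 0}B_j\frac{x^j}{j!}$, $S(n,k)$ are the Stirling numbers of the second kind (with $S(n,k)=0$ for $k>n$), and sums whose upper limit is smaller than the lower limit are $0$. -/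

import Mathlib

/-- The integers `T_{N,j} = (j-1)! ∑_{n=2}^{N} C(N,n) 2^n [(-1)^n S(n+1,j) + (-1)^j S(n,j-1)]`,
with `S` the Stirling numbers of the second kind. Only the values with `j ≥ 2` are used. -/
def momentT (N j : ℕ) : ℤ :=
  ((j - 1).factorial : ℤ) * ∑ n ∈ Finset.Icc 2 N, (N.choose n : ℤ) * 2 ^ n *
    ((-1) ^ n * (Nat.stirlingSecond (n + 1) j : ℤ)
      + (-1) ^ j * (Nat.stirlingSecond n (j - 1) : ℤ))

/-- The weight `|Γ(1/2 + it) ζ(1/2 + it)|²` on the critical line. -/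
noncomputable def gammaZetaSq (t : ℝ) : ℝ :=
  ‖Complex.Gamma (1 / 2 + Complex.I * (t : ℂ)) * riemannZeta (1 / 2 + Complex.I * (t : ℂ))‖ ^ 2

/-! Let f(x) = 1/(eˣ - 1) - 1/x (`planckKernel`). For 0 < Re s < 1 its Mellin transform is Γ(s)ζ(s)
(`mellin_planckKernel`). With x = e⁻ᵘ, the function g(u) = e^{-u/2} f(e⁻ᵘ) therefore has Fourier
transform Γζ(1/2 + it) at frequency t/2π. Since g is Schwartz (`logKernelSchwartz`), the moments
converge, and Plancherel applied to g and its derivative of order 2N turns the normalised moment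
into ∫ g · (-2 d/du)^{2N} g (`integral_pow_mul_norm_fourier_sq`).

In the variable x the operator -2 d/du becomes 1 + 2θ with θ = x d/dx, and θⁿ = ∑ₖ S(n,k) xᵏ Dᵏ. So
the moment equals ∑ₙ C(2N,n) 2ⁿ ∑ₖ S(n,k) Lₖ with Lₖ = ∫₀^∞ xᵏ f f⁽ᵏ⁾.

To find Lₖ for k ≥ 1, write f⁽ᵏ⁾ through Eₖ(x) = ∑ mᵏ e^{-mx}. By Faulhaber's formula E₀Eₖ is a
combination of the E_{k+1-r} with Bernoulli coefficients (`expSum_zero_mul`). The terms r ≥ 2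
integrate to multiples of ζ(r)Bᵣ; the rest reduces to derivatives of f, a harmonic number and one
constant q (`integral_pow_mul_planckKernel_mul`). The constant is q = -(log 2π - γ)/2, read off from
(s - 1)ζ(s) and its derivative at s = 0 and s = 1 (`integral_binetIntegrand`). Stirling number
identities then sum the Lₖ (`sum_choose_stirlingSum_eq`). -/

/-! ### Stirling transforms of factorial sequences. -/

/-- The linear functional `a ↦ ∑ₖ S(n,k) aₖ`. -/
noncomputable def stirlingSum (n : ℕ) (a : ℕ → ℝ) : ℝ :=
  ∑ k ∈ Finset.range (n + 1), (Nat.stirlingSecond n k : ℝ) * a k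

lemma stirlingSum_zero (a : ℕ → ℝ) : stirlingSum 0 a = a 0 := by
  simp [stirlingSum]

lemma stirlingSum_eq_sum_range {n m : ℕ} (h : n < m) (a : ℕ → ℝ) :
    stirlingSum n a = ∑ k ∈ Finset.range m, (Nat.stirlingSecond n k : ℝ) * a k := by
  refine Finset.sum_subset (Finset.range_mono h) fun k _ hk => ?_
  rw [Nat.stirlingSecond_eq_zero_of_lt (by simpa [Nat.lt_succ_iff] using hk)]
  simp

/-- The Stirling recurrence, moved onto the sequence. For aₖ = xᵏ f⁽ᵏ⁾ the new sequence is θaₖ, so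
this encodes θⁿ = ∑ S(n,k) xᵏ Dᵏ; it also drives the inductions below. -/
lemma stirlingSum_succ (n : ℕ) (a : ℕ → ℝ) :
    stirlingSum (n + 1) a = stirlingSum n (fun k => k * a k + a (k + 1)) := by
  rw [stirlingSum, Finset.sum_range_succ', Nat.stirlingSecond_succ_zero]
  simp only [Nat.stirlingSecond_succ_succ, mul_add, stirlingSum, Finset.sum_add_distrib]
  push_cast
  simp only [add_mul, Finset.sum_add_distrib, zero_mul, add_zero]
  congr 1
  have h := Finset.sum_range_succ' (fun k => (Nat.stirlingSecond n k : ℝ) * (k * a k)) (n + 1)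
  rw [Finset.sum_range_succ, Nat.stirlingSecond_eq_zero_of_lt (Nat.lt_succ_self n)] at h
  simp only [Nat.cast_zero, zero_mul, mul_zero, add_zero] at h
  rw [h, ← Finset.sum_add_distrib]
  refine Finset.sum_congr rfl fun k _ => ?_
  push_cast
  ring

lemma stirlingSum_congr {n : ℕ} {a b : ℕ → ℝ} (h : ∀ k ≤ n, a k = b k) :
    stirlingSum n a = stirlingSum n b :=
  Finset.sum_congr rfl fun k hk => by rw [h k (Nat.lt_succ_iff.mp (Finset.mem_range.mp hk))]

lemma stirlingSum_add (n : ℕ) (a b : ℕ → ℝ) :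
    stirlingSum n (fun k => a k + b k) = stirlingSum n a + stirlingSum n b := by
  simp only [stirlingSum, mul_add, Finset.sum_add_distrib]

lemma stirlingSum_const_mul (n : ℕ) (c : ℝ) (a : ℕ → ℝ) :
    stirlingSum n (fun k => c * a k) = c * stirlingSum n a := by
  simp only [stirlingSum, Finset.mul_sum]
  exact Finset.sum_congr rfl fun k _ => by ring

lemma stirlingSum_sum {ι : Type*} (n : ℕ) (s : Finset ι) (a : ι → ℕ → ℝ) :
    stirlingSum n (fun k => ∑ i ∈ s, a i k) = ∑ i ∈ s, stirlingSum n (a i) := by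
  simp only [stirlingSum, Finset.mul_sum]
  exact Finset.sum_comm

lemma stirlingSum_single (n i : ℕ) (c : ℝ) :
    stirlingSum n (fun k => if k = i then c else 0) = Nat.stirlingSecond n i * c := by
  rw [stirlingSum_eq_sum_range (Nat.lt_succ_of_le (le_max_left n i))]
  simp

lemma stirlingSum_factorial (n : ℕ) :
    stirlingSum n (fun k => (-1) ^ k * (k.factorial : ℝ)) = (-1) ^ n := by
  induction n with
  | zero => simp [stirlingSum_zero]
  | succ n ih =>
    rw [stirlingSum_succ, pow_succ, ← ih, mul_comm, ← stirlingSum_const_mul]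
    refine stirlingSum_congr fun k _ => ?_
    rw [Nat.factorial_succ]
    push_cast
    ring

lemma stirlingSum_factorial_harmonic (n : ℕ) :
    stirlingSum n (fun k => (-1) ^ k * (k.factorial : ℝ) * ((harmonic k : ℚ) : ℝ))
      = (-1) ^ n * n := by
  induction n with
  | zero => simp [stirlingSum_zero]
  | succ n ih =>
    have h : (-1 : ℝ) ^ (n + 1) * ((n + 1 : ℕ) : ℝ)
        = (-1) * ((-1) ^ n * n) + (-1) * (-1) ^ n := by
      push_cast; ring
    rw [stirlingSum_succ, h, ← ih]
    rw [← stirlingSum_factorial n]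
    rw [← stirlingSum_const_mul, ← stirlingSum_const_mul, ← stirlingSum_add]
    refine stirlingSum_congr fun k _ => ?_
    rw [Nat.factorial_succ, harmonic_succ]
    push_cast
    have : (k : ℝ) + 1 ≠ 0 := by positivity
    field_simp
    ring

/-- The recurrence sends this sequence to -1 at k = 0 and to 0 elsewhere. The term k = 0 is 1/0 = 0
by convention. -/
lemma stirlingSum_factorial_div_self (n : ℕ) :
    stirlingSum n (fun k => (-1) ^ k * (k.factorial : ℝ) / k) = if n = 1 then -1 else 0 := by
  cases n with
  | zero => simp [stirlingSum_zero]
  | succ n =>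
    have h : stirlingSum n (fun k => if k = 0 then (-1 : ℝ) else 0)
        = if n + 1 = 1 then -1 else 0 := by
      rw [stirlingSum_single]
      cases n <;> simp
    rw [stirlingSum_succ, ← h]
    refine stirlingSum_congr fun k _ => ?_
    rcases eq_or_ne k 0 with rfl | hk
    · simp
    · rw [if_neg hk, Nat.factorial_succ]
      have : (k : ℝ) ≠ 0 := by exact_mod_cast hk
      have h' : (k : ℝ) + 1 ≠ 0 := by positivity
      push_cast
      field_simp
      ring

lemma stirlingSum_factorial_choose (n i : ℕ) :
    stirlingSum n (fun k => (-1) ^ k * (k.factorial : ℝ) * (k.choose i : ℝ))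
      = (-1) ^ n * (i.factorial : ℝ) * (Nat.stirlingSecond (n + 1) (i + 1) : ℝ) := by
  induction n generalizing i with
  | zero => cases i <;> simp [stirlingSum_zero, Nat.stirlingSecond]
  | succ n ih =>
    cases i with
    | zero =>
      simpa [Nat.stirlingSecond_one_right] using stirlingSum_factorial (n + 1)
    | succ i =>
      rw [Nat.stirlingSecond_succ_succ (n + 1) (i + 1)]
      have h : (-1 : ℝ) ^ (n + 1) * ((i + 1).factorial : ℝ)
          * (((i + 1 + 1) * Nat.stirlingSecond (n + 1) (i + 1 + 1)
            + Nat.stirlingSecond (n + 1) (i + 1) : ℕ) : ℝ)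
          = (-((i : ℝ) + 2)) * ((-1) ^ n * ((i + 1).factorial : ℝ)
              * (Nat.stirlingSecond (n + 1) (i + 1 + 1) : ℝ))
            + (-((i : ℝ) + 1)) * ((-1) ^ n * (i.factorial : ℝ)
              * (Nat.stirlingSecond (n + 1) (i + 1) : ℝ)) := by
        rw [Nat.factorial_succ]; push_cast; ring
      rw [stirlingSum_succ, h, ← ih, ← ih, ← stirlingSum_const_mul, ← stirlingSum_const_mul,
        ← stirlingSum_add]
      refine stirlingSum_congr fun k _ => ?_
      have e1 : ((k + 1).choose (i + 1) : ℝ) = k.choose i + k.choose (i + 1) := by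
        exact_mod_cast Nat.choose_succ_succ k i
      have e2 : ((k : ℝ) + 1) * k.choose i = (k.choose i + k.choose (i + 1)) * (i + 1) := by
        rw [← e1]; exact_mod_cast Nat.add_one_mul_choose_eq k i
      rw [e1, Nat.factorial_succ, pow_succ]
      push_cast
      linear_combination (-(-1) ^ k * (k.factorial : ℝ)) * e2

lemma sum_choose_mul_stirlingSecond (n k : ℕ) :
    ∑ i ∈ Finset.range (n + 1), n.choose i * Nat.stirlingSecond i k
      = Nat.stirlingSecond (n + 1) (k + 1) := by
  induction n generalizing k with
  | zero => cases k <;> simp [Nat.stirlingSecond]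
  | succ n ih =>
    have hp : ∑ i ∈ Finset.range (n + 2), (n + 1).choose i * Nat.stirlingSecond i k
        = (∑ i ∈ Finset.range (n + 1), n.choose i * Nat.stirlingSecond (i + 1) k)
          + ∑ i ∈ Finset.range (n + 1), n.choose i * Nat.stirlingSecond i k := by
      rw [Finset.sum_range_succ']
      simp only [Nat.choose_succ_succ, add_mul, Finset.sum_add_distrib]
      rw [add_assoc]
      congr 1
      have h := Finset.sum_range_succ' (fun i => n.choose i * Nat.stirlingSecond i k) (n + 1)
      rw [Finset.sum_range_succ, Nat.choose_succ_self, zero_mul, add_zero] at h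
      simpa using h.symm
    rw [hp, ih]
    cases k with
    | zero =>
      simp [Nat.stirlingSecond_one_right]
    | succ k =>
      have e : ∑ i ∈ Finset.range (n + 1), n.choose i * Nat.stirlingSecond (i + 1) (k + 1)
          = (k + 1) * Nat.stirlingSecond (n + 1) (k + 1 + 1)
            + Nat.stirlingSecond (n + 1) (k + 1) := by
        rw [← ih, ← ih, Finset.mul_sum, ← Finset.sum_add_distrib]
        exact Finset.sum_congr rfl fun i _ => by rw [Nat.stirlingSecond_succ_succ]; ring
      rw [e, Nat.stirlingSecond_succ_succ (n + 1) (k + 1)]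
      ring

/-- Since ∑ᵢ C(n,i) S(i,k) = S(n+1,k+1), the left side is a Stirling sum of order n + 1 of the
shifted sequence. The truncated k - 1 at k = 0 is harmless because of the factor k. -/
lemma sum_choose_mul_stirlingSum (n : ℕ) (a : ℕ → ℝ) :
    ∑ i ∈ Finset.range (n + 1), (n.choose i : ℝ) * stirlingSum i a
      = stirlingSum n (fun k => (k : ℝ) * a (k - 1)) + stirlingSum n a := by
  have h1 : ∑ i ∈ Finset.range (n + 1), (n.choose i : ℝ) * stirlingSum i a
      = ∑ k ∈ Finset.range (n + 1), (Nat.stirlingSecond (n + 1) (k + 1) : ℝ) * a k := by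
    have : ∀ i ∈ Finset.range (n + 1), (n.choose i : ℝ) * stirlingSum i a
        = ∑ k ∈ Finset.range (n + 1), (n.choose i : ℝ) * Nat.stirlingSecond i k * a k := by
      intro i hi
      rw [stirlingSum_eq_sum_range (Finset.mem_range.mp hi), Finset.mul_sum]
      exact Finset.sum_congr rfl fun k _ => by ring
    rw [Finset.sum_congr rfl this, Finset.sum_comm]
    refine Finset.sum_congr rfl fun k _ => ?_
    rw [← Finset.sum_mul, ← sum_choose_mul_stirlingSecond]
    push_cast
    rfl
  have h2 := stirlingSum_succ n (fun k => a (k - 1))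
  rw [stirlingSum, Finset.sum_range_succ'] at h2
  simp only [Nat.stirlingSecond_succ_zero, Nat.cast_zero, zero_mul, add_zero,
    Nat.add_sub_cancel] at h2
  rw [h1, h2, stirlingSum_add]

/-- Both sides satisfy the recurrence ∑_{i<m} C(m,i) bᵢ = [m = 1] that determines the Bernoulli
numbers. -/
lemma stirlingSum_factorial_div_succ (n : ℕ) :
    stirlingSum n (fun k => (-1) ^ k * (k.factorial : ℝ) / (k + 1)) = ((bernoulli n : ℚ) : ℝ) := by
  set a : ℕ → ℝ := fun k => (-1) ^ k * (k.factorial : ℝ) / (k + 1) with ha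
  have key : ∀ m, ∑ i ∈ Finset.range m, (m.choose i : ℝ) * stirlingSum i a
      = if m = 1 then 1 else 0 := by
    intro m
    have h := sum_choose_mul_stirlingSum m a
    rw [Finset.sum_range_succ, Nat.choose_self, Nat.cast_one, one_mul] at h
    rw [add_right_cancel h]
    have e : stirlingSum m (fun k => (k : ℝ) * a (k - 1))
        = (-1) * stirlingSum m (fun k => (-1) ^ k * (k.factorial : ℝ) / k) := by
      rw [← stirlingSum_const_mul]
      refine stirlingSum_congr fun k _ => ?_
      cases k with
      | zero => simp
      | succ k =>
        have : (k : ℝ) + 1 ≠ 0 := by positivity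
        simp only [ha, Nat.add_sub_cancel, Nat.factorial_succ]
        push_cast
        field_simp
        ring
    rw [e, stirlingSum_factorial_div_self]
    split_ifs <;> simp
  induction n using Nat.strong_induction_on with
  | _ n ih =>
    have h1 := key (n + 1)
    have h2 : ∑ i ∈ Finset.range (n + 1), ((n + 1).choose i : ℝ) * ((bernoulli i : ℚ) : ℝ)
        = if n + 1 = 1 then 1 else 0 := by
      have := sum_bernoulli (n + 1)
      have := congrArg (fun q : ℚ => (q : ℝ)) this
      push_cast at this
      rw [this]
      push_cast
      split_ifs <;> simp
    rw [Finset.sum_range_succ] at h1 h2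
    rw [Finset.sum_congr rfl fun i hi => by rw [ih i (Finset.mem_range.mp hi)]] at h1
    have h3 := h1.trans h2.symm
    have h4 := add_left_cancel h3
    have h5 : (((n + 1).choose n : ℕ) : ℝ) ≠ 0 := by
      rw [Nat.choose_succ_self_right]; positivity
    exact mul_left_cancel₀ h5 h4

/-! ### Binomial sums with weights 2ⁿ, and the coefficients T. -/

/-- This is 2ᴹ times the value of the Bernoulli polynomial, B_M(1/2) = (2^{1-M} - 1) B_M. -/
lemma sum_choose_two_pow_bernoulli (M : ℕ) :
    ∑ n ∈ Finset.range (M + 1), (M.choose n : ℝ) * 2 ^ n * ((bernoulli n : ℚ) : ℝ)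
      = (2 - 2 ^ M) * ((bernoulli M : ℚ) : ℝ) := by
  have h := bernoulliFun_eval_half M
  rw [bernoulliFun, Polynomial.bernoulli_def] at h
  simp only [Polynomial.map_sum, Polynomial.eval_finsetSum, Polynomial.map_monomial,
    Polynomial.eval_monomial] at h
  have h2 : (2 : ℝ) ^ M ≠ 0 := by positivity
  have h3 : (2 - 2 ^ M) * ((bernoulli M : ℚ) : ℝ) = 2 ^ M * ((2 / 2 ^ M - 1) * (bernoulli M : ℚ)) := by
    field_simp
  rw [h3, ← h, Finset.mul_sum, ← Finset.sum_range_reflect]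
  refine Finset.sum_congr rfl fun i hi => ?_
  have hi' : i ≤ M := Nat.lt_succ_iff.mp (Finset.mem_range.mp hi)
  have e : M + 1 - 1 - i = M - i := by omega
  have e2 : (2 : ℝ) ^ M = 2 ^ (M - i) * 2 ^ i := by rw [← pow_add]; congr 1; omega
  rw [e, Nat.choose_symm hi', e2]
  simp
  field_simp

lemma sum_choose_neg_two_pow (N : ℕ) :
    ∑ n ∈ Finset.range (2 * N + 1), ((2 * N).choose n : ℝ) * 2 ^ n * (-1) ^ n = 1 := by
  have h := add_pow (-2 : ℝ) 1 (2 * N)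
  rw [show (-2 : ℝ) + 1 = -1 by norm_num, Even.neg_one_pow (even_two_mul N)] at h
  refine Eq.trans (Finset.sum_congr rfl fun n _ => ?_) h.symm
  rw [show (-2 : ℝ) = 2 * (-1) by norm_num, mul_pow]
  ring

lemma sum_choose_neg_two_pow_mul_self (N : ℕ) :
    ∑ n ∈ Finset.range (2 * N + 1), ((2 * N).choose n : ℝ) * 2 ^ n * ((-1) ^ n * n) = 4 * N := by
  cases N with
  | zero => simp
  | succ N =>
    rw [Finset.sum_range_succ']
    have h := add_pow (-2 : ℝ) 1 (2 * N + 1)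
    rw [show (-2 : ℝ) + 1 = -1 by norm_num, Odd.neg_one_pow ⟨N, rfl⟩] at h
    have e : ∀ n ∈ Finset.range (2 * (N + 1)), ((2 * (N + 1)).choose (n + 1) : ℝ) * 2 ^ (n + 1)
        * ((-1) ^ (n + 1) * ((n + 1 : ℕ) : ℝ))
        = (-2 * (2 * (N + 1))) * ((-2) ^ n * 1 ^ (2 * N + 1 - n) * ((2 * N + 1).choose n : ℝ)) := by
      intro n _
      have := Nat.add_one_mul_choose_eq (2 * N + 1) n
      have h' : ((2 * (N + 1)).choose (n + 1) : ℝ) * (n + 1)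
          = (2 * (N + 1)) * ((2 * N + 1).choose n : ℝ) := by
        rw [show 2 * (N + 1) = 2 * N + 1 + 1 by ring]
        rw [show (2 * ((N : ℝ) + 1)) = ((2 * N + 1 + 1 : ℕ) : ℝ) by push_cast; ring]
        exact_mod_cast this.symm
      rw [show (-2 : ℝ) ^ n = 2 ^ n * (-1) ^ n by rw [← mul_pow]; norm_num]
      rw [one_pow, pow_succ, pow_succ]
      push_cast
      linear_combination (-2 * 2 ^ n * (-1) ^ n) * h'
    rw [Finset.sum_congr rfl e, ← Finset.mul_sum, show 2 * (N + 1) = 2 * N + 1 + 1 by ring, ← h]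
    push_cast
    ring

/-- Starting the sum at n = 2 loses nothing: for j ≥ 2 the bracket vanishes at n = 0, and at n = 1
its two parts cancel when j = 2 and vanish when j > 2. -/
lemma momentT_eq (M : ℕ) {j : ℕ} (hj : 2 ≤ j) :
    (momentT M j : ℝ) = ∑ n ∈ Finset.range (M + 1), (M.choose n : ℝ) * 2 ^ n *
      (((j - 1).factorial : ℝ) * ((-1) ^ n * (Nat.stirlingSecond (n + 1) j : ℝ)
        + (-1) ^ j * (Nat.stirlingSecond n (j - 1) : ℝ))) := by
  have hsub : Finset.Icc 2 M ⊆ Finset.range (M + 1) := fun n hn => by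
    rw [Finset.mem_Icc] at hn; rw [Finset.mem_range]; omega
  rw [← Finset.sum_subset hsub, momentT]
  · push_cast
    rw [Finset.mul_sum]
    exact Finset.sum_congr rfl fun n _ => by ring
  · intro n _ hn
    have hn2 : n < 2 := by
      simp only [Finset.mem_Icc, Finset.mem_range] at *; omega
    obtain ⟨i, rfl⟩ : ∃ i, j = i + 2 := ⟨j - 2, by omega⟩
    interval_cases n
    · simp [Nat.stirlingSecond]
    · rcases i with _ | i <;> simp [Nat.stirlingSecond]

/-! ### Algebraic summation of the integrals Lₖ. -/

/-- The value of `∫₀^∞ xᵏ f f⁽ᵏ⁾` for `k ≥ 1`, in terms of `q = ∫₀^∞ (f/x + 1/(2x) + f/2)` and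
`z r = ζ(r) Bᵣ`. -/
noncomputable def momentTerm (q : ℝ) (z : ℕ → ℝ) (k : ℕ) : ℝ :=
  (-1) ^ k * (k.factorial : ℝ) * (-1 / (2 * (k + 1)) + 1 / (2 * k) - q - ((harmonic k : ℚ) : ℝ) / 2
    + ∑ r ∈ Finset.Icc 2 k, ((k + 1).choose r : ℝ) / (k + 1) * z r)

/-- Since C(k+1,j)/(k+1) = C(k,j-1)/j, the zeta sum can run up to a bound M independent of k. The
only nonzero new term is j = k + 1, which the indicator cancels; it is the source of S(n, j-1) in T.
-/
lemma momentTerm_eq (q : ℝ) (z : ℕ → ℝ) {k M : ℕ} (hk : k ≤ M) :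
    momentTerm q z k = (-1 / 2) * ((-1) ^ k * (k.factorial : ℝ) / (k + 1))
      + (1 / 2) * ((-1) ^ k * (k.factorial : ℝ) / k)
      + (-q) * ((-1) ^ k * (k.factorial : ℝ))
      + (-1 / 2) * ((-1) ^ k * (k.factorial : ℝ) * ((harmonic k : ℚ) : ℝ))
      + ∑ j ∈ Finset.Icc 2 M, ((z j / j) * ((-1) ^ k * (k.factorial : ℝ) * (k.choose (j - 1) : ℝ))
          + (z j / j) * (if k = j - 1 then (-1) ^ j * ((j - 1).factorial : ℝ) else 0)) := by
  have hsum : (-1) ^ k * (k.factorial : ℝ) *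
      ∑ r ∈ Finset.Icc 2 k, ((k + 1).choose r : ℝ) / (k + 1) * z r
      = ∑ j ∈ Finset.Icc 2 M, ((z j / j) * ((-1) ^ k * (k.factorial : ℝ) * (k.choose (j - 1) : ℝ))
          + (z j / j) * (if k = j - 1 then (-1) ^ j * ((j - 1).factorial : ℝ) else 0)) := by
    rw [Finset.mul_sum]
    have hk1 : (k : ℝ) + 1 ≠ 0 := by positivity
    have aux : ∀ j ∈ Finset.Icc 2 k, (-1) ^ k * (k.factorial : ℝ) *
        (((k + 1).choose j : ℝ) / (k + 1) * z j)
        = (z j / j) * ((-1) ^ k * (k.factorial : ℝ) * (k.choose (j - 1) : ℝ))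
          + (z j / j) * (if k = j - 1 then (-1) ^ j * ((j - 1).factorial : ℝ) else 0) := by
      intro j hj
      rw [Finset.mem_Icc] at hj
      rw [if_neg (by omega)]
      obtain ⟨i, rfl⟩ : ∃ i, j = i + 1 := ⟨j - 1, by omega⟩
      have h : ((k : ℝ) + 1) * (k.choose i : ℝ) = ((k + 1).choose (i + 1) : ℝ) * (i + 1) := by
        exact_mod_cast Nat.add_one_mul_choose_eq k i
      have hi : (i : ℝ) + 1 ≠ 0 := by positivity
      simp only [Nat.add_sub_cancel]
      push_cast
      field_simp
      linear_combination ((-1 : ℝ) ^ (k + 1) * (k.factorial : ℝ) * z (i + 1)) * h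
    rw [Finset.sum_congr rfl aux]
    refine Finset.sum_subset (Finset.Icc_subset_Icc_right hk) fun j hj hj' => ?_
    simp only [Finset.mem_Icc, not_and, not_le] at hj hj'
    have hj'' := hj' hj.1
    obtain ⟨i, rfl⟩ : ∃ i, j = i + 1 := ⟨j - 1, by omega⟩
    simp only [Nat.add_sub_cancel]
    rcases eq_or_ne k i with rfl | hki
    · simp [pow_succ]
    · rw [if_neg hki, Nat.choose_eq_zero_of_lt (by omega)]
      simp
  rw [momentTerm, mul_add, hsum, ← div_div, ← div_div]
  congr 1
  ring

lemma stirlingSum_momentTerm (q : ℝ) (z : ℕ → ℝ) {n M : ℕ} (hn : n ≤ M) :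
    stirlingSum n (momentTerm q z) = (-1 / 2) * ((bernoulli n : ℚ) : ℝ)
      + (1 / 2) * (if n = 1 then -1 else 0) + (-q) * (-1) ^ n + (-1 / 2) * ((-1) ^ n * n)
      + ∑ j ∈ Finset.Icc 2 M, (z j / j) * (((j - 1).factorial : ℝ) *
        ((-1) ^ n * (Nat.stirlingSecond (n + 1) j : ℝ)
          + (-1) ^ j * (Nat.stirlingSecond n (j - 1) : ℝ))) := by
  rw [stirlingSum_congr fun k hk => momentTerm_eq q z (hk.trans hn)]
  simp only [stirlingSum_add, stirlingSum_const_mul, stirlingSum_sum, stirlingSum_factorial,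
    stirlingSum_factorial_harmonic, stirlingSum_factorial_div_self, stirlingSum_factorial_div_succ,
    stirlingSum_factorial_choose, stirlingSum_single]
  congr 1
  refine Finset.sum_congr rfl fun j hj => ?_
  obtain ⟨i, rfl⟩ : ∃ i, j = i + 1 := ⟨j - 1, by rw [Finset.mem_Icc] at hj; omega⟩
  simp only [Nat.add_sub_cancel]
  ring

lemma sum_choose_stirlingSum_eq (N : ℕ) (q : ℝ) (z L : ℕ → ℝ) (hL0 : L 0 = -1 / 2 - 2 * q)
    (hL : ∀ k, 1 ≤ k → L k = momentTerm q z k) :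
    ∑ n ∈ Finset.range (2 * N + 1), ((2 * N).choose n : ℝ) * 2 ^ n * stirlingSum n L
      = -2 * q - 4 * N + ((4 : ℝ) ^ N / 2 - 1) * ((bernoulli (2 * N) : ℚ) : ℝ)
        + ∑ j ∈ Finset.Icc 2 (2 * N), (momentT (2 * N) j : ℝ) * (z j / j) := by
  -- At k = 0 the convention 1/0 = 0 gives `momentTerm` the value -1/2 - q, so L 0 differs from it
  -- by -q.
  have hL' : L = fun k => momentTerm q z k + if k = 0 then -q else 0 := by
    funext k
    rcases Nat.eq_zero_or_pos k with rfl | hk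
    · rw [hL0]; simp [momentTerm]; ring
    · rw [hL k hk, if_neg hk.ne', add_zero]
  have h1 : ∀ n ∈ Finset.range (2 * N + 1), ((2 * N).choose n : ℝ) * 2 ^ n * stirlingSum n L
      = (-1 / 2) * (((2 * N).choose n : ℝ) * 2 ^ n * ((bernoulli n : ℚ) : ℝ))
        + (if n = 1 then -(2 * N : ℝ) else 0)
        + (-q) * (((2 * N).choose n : ℝ) * 2 ^ n * (-1) ^ n)
        + (-1 / 2) * (((2 * N).choose n : ℝ) * 2 ^ n * ((-1) ^ n * n))
        + (if n = 0 then -q else 0)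
        + ∑ j ∈ Finset.Icc 2 (2 * N), ((2 * N).choose n : ℝ) * 2 ^ n * (((j - 1).factorial : ℝ) *
            ((-1) ^ n * (Nat.stirlingSecond (n + 1) j : ℝ)
              + (-1) ^ j * (Nat.stirlingSecond n (j - 1) : ℝ))) * (z j / j) := by
    intro n hn
    rw [hL', stirlingSum_add, stirlingSum_single,
      stirlingSum_momentTerm q z (Nat.lt_succ_iff.mp (Finset.mem_range.mp hn))]
    have e : ∀ A B C : ℝ, ∀ s : Finset ℕ, ∀ u v : ℕ → ℝ,
        A * ((B + ∑ j ∈ s, u j * v j) + C) = A * B + A * C + ∑ j ∈ s, A * v j * u j := by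
      intro A B C s u v
      rw [mul_add, mul_add, Finset.mul_sum, add_right_comm]
      congr 1
      exact Finset.sum_congr rfl fun j _ => by ring
    rw [e]
    congr 1
    rcases eq_or_ne n 0 with rfl | h0
    · simp

    · have : Nat.stirlingSecond n 0 = 0 := by
        obtain ⟨m, rfl⟩ := Nat.exists_eq_succ_of_ne_zero h0; simp
      rw [this, if_neg h0]
      rcases eq_or_ne n 1 with rfl | h1
      · simp; ring
      · rw [if_neg h1, if_neg h1]; ring
  rw [Finset.sum_congr rfl h1]
  simp only [Finset.sum_add_distrib, ← Finset.mul_sum, sum_choose_two_pow_bernoulli,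
    sum_choose_neg_two_pow, sum_choose_neg_two_pow_mul_self]
  rw [Finset.sum_comm]
  simp only [← Finset.sum_mul]
  have hT : ∀ j ∈ Finset.Icc 2 (2 * N), (momentT (2 * N) j : ℝ) * (z j / j) = _ :=
    fun j hj => by rw [momentT_eq _ (Finset.mem_Icc.mp hj).1]
  rw [Finset.sum_congr rfl hT]
  congr 1
  have h4 : (2 : ℝ) ^ (2 * N) = 4 ^ N := by rw [pow_mul]; norm_num
  rw [h4]
  -- The index n = 1 lies in the range only when N > 0; there its -2N joins the -2N from the
  -- harmonic terms to give -4N.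
  rcases Nat.eq_zero_or_pos N with rfl | hN
  · simp; ring
  · rw [Finset.sum_ite_eq', Finset.sum_ite_eq', if_pos (by simp; omega), if_pos (by simp)]
    ring

/-! ### The series ∑ mᵏ e^{-mx} and its products and moments. -/

/-- The Lambert-type series `∑_{m ≥ 1} mᵏ e^{-mx}`. -/
noncomputable def expSum (k : ℕ) (x : ℝ) : ℝ :=
  ∑' m : ℕ, ((m : ℝ) + 1) ^ k * Real.exp (-((m : ℝ) + 1) * x)

lemma summable_expSum (k : ℕ) {x : ℝ} (hx : 0 < x) :
    Summable fun m : ℕ => ((m : ℝ) + 1) ^ k * Real.exp (-((m : ℝ) + 1) * x) := by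
  have h := (summable_nat_add_iff 1).mpr (Real.summable_pow_mul_exp_neg_nat_mul k hx)
  refine h.congr fun m => ?_
  push_cast
  ring_nf

lemma expSum_nonneg (k : ℕ) (x : ℝ) : 0 ≤ expSum k x :=
  tsum_nonneg fun m => by positivity

lemma hasDerivAt_expSum (k : ℕ) {x : ℝ} (hx : 0 < x) :
    HasDerivAt (expSum k) (-expSum (k + 1) x) x := by
  -- On (x/2, ∞) the differentiated terms are dominated by their values at x/2.
  have hs : ∀ m : ℕ, ∀ y ∈ Set.Ioi (x / 2),
      HasDerivAt (fun y => ((m : ℝ) + 1) ^ k * Real.exp (-((m : ℝ) + 1) * y))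
        (-(((m : ℝ) + 1) ^ (k + 1) * Real.exp (-((m : ℝ) + 1) * y))) y := by
    intro m y _
    have h := (((hasDerivAt_id y).const_mul (-((m : ℝ) + 1))).exp).const_mul (((m : ℝ) + 1) ^ k)
    refine h.congr_deriv ?_
    simp only [id_eq, mul_one]
    ring
  have h := hasDerivAt_tsum_of_isPreconnected (summable_expSum (k + 1) (half_pos hx)) isOpen_Ioi
    isPreconnected_Ioi hs (fun m y hy => ?_) (y₀ := x) (by simpa using hx) (summable_expSum k hx)
    (y := x) (by simpa using hx)
  · rw [tsum_neg] at h
    exact h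
  · rw [norm_neg, Real.norm_of_nonneg (by positivity)]
    refine mul_le_mul_of_nonneg_left (Real.exp_le_exp.mpr ?_) (by positivity)
    have : 0 ≤ (m : ℝ) + 1 := by positivity
    nlinarith [Set.mem_Ioi.mp hy]

lemma expSum_zero {x : ℝ} (hx : 0 < x) : expSum 0 x = (Real.exp x - 1)⁻¹ := by
  have h1 : Real.exp (-x) < 1 := by simpa using hx
  have h := tsum_geometric_of_lt_one (Real.exp_pos (-x)).le h1
  have e : ∀ m : ℕ, ((m : ℝ) + 1) ^ 0 * Real.exp (-((m : ℝ) + 1) * x)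
      = Real.exp (-x) * Real.exp (-x) ^ m := by
    intro m
    rw [← Real.exp_nat_mul, ← Real.exp_add]
    ring_nf
  rw [expSum, tsum_congr e, tsum_mul_left, h, Real.exp_neg]
  have h2 : 1 < Real.exp x := by simpa using hx
  have h3 : Real.exp x - 1 ≠ 0 := by linarith
  have h4 : Real.exp x ≠ 0 := (Real.exp_pos x).ne'
  have h5 : 1 - (Real.exp x)⁻¹ ≠ 0 := by
    rw [Real.exp_neg] at h1; linarith
  field_simp

lemma expSum_le (k : ℕ) {x : ℝ} (hx : 1 ≤ x) :
    expSum k x ≤ Real.exp 1 * expSum k 1 * Real.exp (-x) := by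
  rw [mul_right_comm, expSum, expSum, ← tsum_mul_left]
  refine (summable_expSum k (by linarith)).tsum_le_tsum (fun m => ?_)
    ((summable_expSum k one_pos).mul_left _)
  have : Real.exp 1 * Real.exp (-x) * (((m : ℝ) + 1) ^ k * Real.exp (-((m : ℝ) + 1) * 1))
      = ((m : ℝ) + 1) ^ k * Real.exp (1 + -x + -((m : ℝ) + 1) * 1) := by
    rw [Real.exp_add, Real.exp_add]; ring
  rw [this]
  gcongr
  have : (0 : ℝ) ≤ m := by positivity
  nlinarith

/-- In the Cauchy product the coefficient of e^{-(M+1)x} is ∑_{i ≤ M} iᵏ, which Faulhaber's formula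
evaluates. The hypothesis k ≥ 1 lets the second series start at m = 0. -/
lemma expSum_zero_mul (k : ℕ) {x : ℝ} (hx : 0 < x) (hk : 1 ≤ k) :
    expSum 0 x * expSum k x = ∑ r ∈ Finset.range (k + 1),
      ((bernoulli r : ℚ) : ℝ) * ((k + 1).choose r : ℝ) / (k + 1) * expSum (k + 1 - r) x := by
  have hk0 : k ≠ 0 := by omega
  have hs0 : Summable fun m : ℕ => (m : ℝ) ^ k * Real.exp (-x * m) :=
    Real.summable_pow_mul_exp_neg_nat_mul k hx
  have e1 : expSum k x = ∑' m : ℕ, (m : ℝ) ^ k * Real.exp (-x * m) := by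
    rw [hs0.tsum_eq_zero_add]
    simp only [CharP.cast_eq_zero, zero_pow hk0, zero_mul, zero_add]
    refine tsum_congr fun m => ?_
    push_cast
    ring_nf
  have hs1 := summable_expSum 0 hx
  have h1 := tsum_mul_tsum_eq_tsum_sum_antidiagonal_of_summable_norm hs1.norm hs0.norm
  rw [← e1] at h1
  rw [expSum, h1]
  have e2 : ∀ M : ℕ, ∑ p ∈ Finset.HasAntidiagonal.antidiagonal M, ((p.1 : ℝ) + 1) ^ 0
        * Real.exp (-((p.1 : ℝ) + 1) * x) * ((p.2 : ℝ) ^ k * Real.exp (-x * p.2))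
      = ∑ r ∈ Finset.range (k + 1), ((bernoulli r : ℚ) : ℝ) * ((k + 1).choose r : ℝ) / (k + 1)
        * (((M : ℝ) + 1) ^ (k + 1 - r) * Real.exp (-((M : ℝ) + 1) * x)) := by
    intro M
    have h2 : ∀ p ∈ Finset.HasAntidiagonal.antidiagonal M, ((p.1 : ℝ) + 1) ^ 0
        * Real.exp (-((p.1 : ℝ) + 1) * x) * ((p.2 : ℝ) ^ k * Real.exp (-x * p.2))
        = (p.2 : ℝ) ^ k * Real.exp (-((M : ℝ) + 1) * x) := by
      intro p hp
      rw [← Finset.HasAntidiagonal.mem_antidiagonal.mp hp]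
      push_cast
      rw [show -((p.1 : ℝ) + p.2 + 1) * x = -((p.1 : ℝ) + 1) * x + -x * p.2 by ring, Real.exp_add]
      ring
    rw [Finset.sum_congr rfl h2, ← Finset.sum_mul,
      Finset.Nat.sum_antidiagonal_eq_sum_range_succ_mk]
    have h3 := Finset.sum_range_reflect (fun i => (i : ℝ) ^ k) (M + 1)
    simp only [Nat.add_sub_cancel] at h3
    have h4 := congrArg (fun q : ℚ => (q : ℝ)) (sum_range_pow (M + 1) k)
    push_cast at h4
    simp only [Nat.succ_eq_add_one]
    rw [h3, h4, Finset.sum_mul]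
    refine Finset.sum_congr rfl fun r _ => ?_
    ring
  rw [tsum_congr e2, Summable.tsum_finsetSum fun r _ => (summable_expSum _ hx).mul_left _]
  exact Finset.sum_congr rfl fun r _ => tsum_mul_left

/-- The real zeta value `∑_{m ≥ 1} m⁻ʲ`. -/
noncomputable def zetaReal (j : ℕ) : ℝ := ∑' m : ℕ, 1 / ((m : ℝ) + 1) ^ j

lemma summable_zetaReal {j : ℕ} (hj : 2 ≤ j) : Summable fun m : ℕ => 1 / ((m : ℝ) + 1) ^ j := by
  have h := (summable_nat_add_iff 1).mpr (Real.summable_one_div_nat_pow.mpr (by omega : 1 < j))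
  exact h.congr fun m => by push_cast; rfl

lemma ofReal_zetaReal {j : ℕ} (hj : 2 ≤ j) : ((zetaReal j : ℝ) : ℂ) = riemannZeta j := by
  rw [zeta_eq_tsum_one_div_nat_add_one_cpow (by simp; omega), zetaReal, Complex.ofReal_tsum]
  refine tsum_congr fun m => ?_
  push_cast
  rw [Complex.cpow_natCast]

lemma integral_pow_mul_expSum {k p j : ℕ} (hj : 2 ≤ j) (h : k + 1 = p + j) :
    MeasureTheory.IntegrableOn (fun x => x ^ k * expSum p x) (Set.Ioi 0) ∧
      ∫ x in Set.Ioi (0 : ℝ), x ^ k * expSum p x = k.factorial * zetaReal j := by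
  have hF : ∀ m : ℕ, MeasureTheory.IntegrableOn
      (fun x : ℝ => x ^ k * (((m : ℝ) + 1) ^ p * Real.exp (-((m : ℝ) + 1) * x))) (Set.Ioi 0) ∧
      ∫ x in Set.Ioi (0 : ℝ), x ^ k * (((m : ℝ) + 1) ^ p * Real.exp (-((m : ℝ) + 1) * x))
        = k.factorial * (1 / ((m : ℝ) + 1) ^ j) := by
    intro m
    have hm : (0 : ℝ) < (m : ℝ) + 1 := by positivity
    have hint := integrableOn_rpow_mul_exp_neg_mul_rpow (p := 1) (s := k) (b := (m : ℝ) + 1)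
      (by have : (0 : ℝ) ≤ k := by positivity
          linarith) one_pos hm
    have hval := Real.integral_rpow_mul_exp_neg_mul_Ioi (a := k + 1) (r := (m : ℝ) + 1)
      (by positivity) hm
    simp only [Real.rpow_natCast, Real.rpow_one, add_sub_cancel_right] at hint hval
    constructor
    · refine (hint.const_mul (((m : ℝ) + 1) ^ p)).congr (Filter.Eventually.of_forall fun x => ?_)
      simp only []
      ring
    · have e : ∀ x : ℝ, x ^ k * (((m : ℝ) + 1) ^ p * Real.exp (-((m : ℝ) + 1) * x))
          = ((m : ℝ) + 1) ^ p * (x ^ k * Real.exp (-(((m : ℝ) + 1) * x))) := by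
        intro x; rw [neg_mul]; ring
      simp only [e]
      rw [MeasureTheory.integral_const_mul, hval, Real.Gamma_nat_eq_factorial,
        show (k : ℝ) + 1 = ((k + 1 : ℕ) : ℝ) by push_cast; rfl, Real.rpow_natCast, h, one_div_pow,
        pow_add]
      field_simp
  have hsum : Summable fun m : ℕ => (k.factorial : ℝ) * (1 / ((m : ℝ) + 1) ^ j) :=
    (summable_zetaReal hj).mul_left _
  have hnorm : ∀ m : ℕ, ∫ x in Set.Ioi (0 : ℝ),
      ‖x ^ k * (((m : ℝ) + 1) ^ p * Real.exp (-((m : ℝ) + 1) * x))‖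
      = k.factorial * (1 / ((m : ℝ) + 1) ^ j) := by
    intro m
    rw [← (hF m).2]
    refine MeasureTheory.setIntegral_congr_fun measurableSet_Ioi fun x hx => ?_
    have : (0 : ℝ) < x := hx
    exact Real.norm_of_nonneg (by positivity)
  have key := MeasureTheory.hasSum_integral_of_summable_integral_norm (fun m => (hF m).1)
    (by simp only [hnorm]; exact hsum)
  have hval : ∫ x in Set.Ioi (0 : ℝ), x ^ k * expSum p x = k.factorial * zetaReal j := by
    rw [zetaReal, ← tsum_mul_left]
    simp only [fun m => (hF m).2, tsum_mul_left] at key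
    rw [key.tsum_eq]
    simp only [expSum]
  refine ⟨?_, hval⟩
  -- A non-integrable function has integral 0 by convention, whereas the value just found is
  -- positive.
  by_contra hcon
  have h0 := MeasureTheory.integral_undef hcon
  rw [hval] at h0
  have hpos : 0 < zetaReal j :=
    (summable_zetaReal hj).tsum_pos (fun m => by positivity) 0 (by positivity)
  have : (0 : ℝ) < k.factorial := by positivity
  nlinarith

/-! ### The kernel f(x) = 1/(eˣ - 1) - 1/x, analytic through 0. -/

lemma AnalyticAt.dslope_self {f : ℝ → ℝ} {a : ℝ} (hf : AnalyticAt ℝ f a) :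
    AnalyticAt ℝ (dslope f a) a := by
  obtain ⟨p, hp⟩ := hf
  exact hp.has_fpower_series_dslope_fslope.analyticAt

lemma analyticAt_dslope {f : ℝ → ℝ} (hf : ∀ x, AnalyticAt ℝ f x) (a x : ℝ) :
    AnalyticAt ℝ (dslope f a) x := by
  rcases eq_or_ne x a with rfl | hx
  · exact (hf x).dslope_self
  · refine AnalyticAt.congr (f := slope f a) ?_ (dslope_eventuallyEq_slope_of_ne f hx).symm
    have h : slope f a = fun y => (y - a)⁻¹ * (f y - f a) := by
      funext y; simp [slope]
    rw [h]
    exact ((analyticAt_id.sub analyticAt_const).inv (sub_ne_zero.mpr hx)).mul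
      ((hf x).sub analyticAt_const)

/-- The real-analytic function on `ℝ` that equals `1/(eˣ-1) - 1/x` for `x ≠ 0`. -/
noncomputable def planckKernel : ℝ → ℝ :=
  dslope (fun y => (dslope Real.exp 0 y)⁻¹) 0

lemma dslope_exp_ne_zero (x : ℝ) : dslope Real.exp 0 x ≠ 0 := by
  rcases eq_or_ne x 0 with rfl | hx
  · simp
  · rw [dslope_of_ne _ hx, slope_def_field]
    have : Real.exp x ≠ Real.exp 0 := fun h => hx (Real.exp_injective h)
    exact div_ne_zero (sub_ne_zero.mpr this) (by simpa using hx)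

lemma analyticAt_planckKernel (x : ℝ) : AnalyticAt ℝ planckKernel x :=
  analyticAt_dslope (fun y => (analyticAt_dslope (fun _ => analyticAt_rexp) 0 y).inv
    (dslope_exp_ne_zero y)) 0 x

lemma planckKernel_of_ne_zero {x : ℝ} (hx : x ≠ 0) :
    planckKernel x = (Real.exp x - 1)⁻¹ - 1 / x := by
  have h : Real.exp x - 1 ≠ 0 := by
    rw [sub_ne_zero, ← Real.exp_zero]
    exact fun h => hx (Real.exp_injective h)
  rw [planckKernel, dslope_of_ne _ hx, slope_def_field, dslope_of_ne _ hx, dslope_same,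
    slope_def_field]
  simp
  field_simp

lemma planckKernel_of_pos {x : ℝ} (hx : 0 < x) : planckKernel x = expSum 0 x - 1 / x := by
  rw [planckKernel_of_ne_zero hx.ne', expSum_zero hx]

/-- Away from 0 one has f(x) + f(-x) = -1; let x tend to 0. -/
lemma planckKernel_zero : planckKernel 0 = -1 / 2 := by
  have hc : Continuous fun x => planckKernel x + planckKernel (-x) := by
    have : Continuous planckKernel :=
      continuous_iff_continuousAt.mpr fun x => (analyticAt_planckKernel x).continuousAt
    fun_prop
  have h : ∀ x ∈ ({0}ᶜ : Set ℝ), planckKernel x + planckKernel (-x) = -1 := by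
    intro x hx
    have hx : x ≠ 0 := by simpa using hx
    rw [planckKernel_of_ne_zero hx, planckKernel_of_ne_zero (neg_ne_zero.mpr hx), Real.exp_neg]
    have h : Real.exp x - 1 ≠ 0 := by
      rw [sub_ne_zero, ← Real.exp_zero]
      exact fun h => hx (Real.exp_injective h)
    have h1 : 1 - Real.exp x ≠ 0 := by
      rw [← neg_sub]; exact neg_ne_zero.mpr h
    have h2 : (Real.exp x)⁻¹ - 1 ≠ 0 := by
      have : (Real.exp x)⁻¹ - 1 = (1 - Real.exp x) / Real.exp x := by field_simp
      rw [this]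
      exact div_ne_zero h1 (Real.exp_pos x).ne'
    have h3 : ((Real.exp x)⁻¹ - 1)⁻¹ = -1 - (Real.exp x - 1)⁻¹ := by
      field_simp
      ring
    rw [h3]
    field_simp
    ring
  have h2 := Set.EqOn.closure (f := fun x => planckKernel x + planckKernel (-x))
    (g := fun _ => (-1 : ℝ)) h hc continuous_const
  have h3 := h2 (x := 0) (by rw [(dense_compl_singleton (0 : ℝ)).closure_eq]; trivial)
  simp only [neg_zero] at h3
  linarith

lemma contDiff_planckKernel {n : WithTop ℕ∞} : ContDiff ℝ n planckKernel :=
  AnalyticOnNhd.contDiff (fun x _ => analyticAt_planckKernel x)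

lemma hasDerivAt_iteratedDeriv_planckKernel (k : ℕ) (x : ℝ) :
    HasDerivAt (iteratedDeriv k planckKernel) (iteratedDeriv (k + 1) planckKernel x) x := by
  rw [iteratedDeriv_succ]
  exact ((contDiff_planckKernel (n := (k + 1 : ℕ))).differentiable_iteratedDeriv k
    (by exact_mod_cast Nat.lt_succ_self k) x).hasDerivAt

lemma continuous_iteratedDeriv_planckKernel (k : ℕ) :
    Continuous (iteratedDeriv k planckKernel) :=
  continuous_iff_continuousAt.mpr fun x =>
    (hasDerivAt_iteratedDeriv_planckKernel k x).continuousAt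

lemma iteratedDeriv_planckKernel (k : ℕ) {x : ℝ} (hx : 0 < x) :
    iteratedDeriv k planckKernel x
      = (-1) ^ k * (expSum k x - (k.factorial : ℝ) / x ^ (k + 1)) := by
  induction k generalizing x with
  | zero => simp [planckKernel_of_pos hx]
  | succ k ih =>
    rw [iteratedDeriv_succ]
    have h : iteratedDeriv k planckKernel =ᶠ[nhds x]
        fun y => (-1) ^ k * (expSum k y - (k.factorial : ℝ) / y ^ (k + 1)) := by
      filter_upwards [Ioi_mem_nhds hx] with y hy using ih hy
    rw [h.deriv_eq]
    have hd := (((hasDerivAt_expSum k hx).sub ((hasDerivAt_const x (k.factorial : ℝ)).div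
      (hasDerivAt_pow (k + 1) x) (by positivity))).const_mul ((-1 : ℝ) ^ k))
    refine Eq.trans hd.deriv ?_
    rw [Nat.factorial_succ, pow_succ]
    push_cast
    field_simp
    ring

/-! ### Decay of the derivatives of f and their integrals. -/

lemma exists_pow_mul_expSum_le (k p n : ℕ) :
    ∃ C : ℝ, 0 ≤ C ∧ ∀ x : ℝ, 1 ≤ x → x ^ k * expSum p x ≤ C / x ^ n := by
  refine ⟨Real.exp 1 * expSum p 1 * ((k + n).factorial : ℝ),
    by have := expSum_nonneg p 1; positivity, fun x hx => ?_⟩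
  have hx0 : 0 < x := by linarith
  have h1 := expSum_le p hx
  have h2 := Real.pow_div_factorial_le_exp x hx0.le (k + n)
  rw [le_div_iff₀ (by positivity)]
  have h3 : x ^ (k + n) * Real.exp (-x) ≤ ((k + n).factorial : ℝ) := by
    rw [div_le_iff₀ (by positivity)] at h2
    rw [Real.exp_neg, ← div_eq_mul_inv, div_le_iff₀ (Real.exp_pos x)]
    linarith
  have h0 := expSum_nonneg p 1
  calc x ^ k * expSum p x * x ^ n
      = x ^ (k + n) * expSum p x := by rw [pow_add]; ring
    _ ≤ x ^ (k + n) * (Real.exp 1 * expSum p 1 * Real.exp (-x)) := by gcongr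
    _ = Real.exp 1 * expSum p 1 * (x ^ (k + n) * Real.exp (-x)) := by ring
    _ ≤ _ := by gcongr

lemma exists_abs_pow_mul_iteratedDeriv_le (k : ℕ) :
    ∃ C : ℝ, 0 ≤ C ∧ ∀ x : ℝ, 0 < x →
      |x ^ k * iteratedDeriv k planckKernel x| ≤ C / (1 + x) := by
  obtain ⟨C, hC0, hC⟩ := exists_pow_mul_expSum_le k k 1
  have hcont : Continuous fun x => x ^ k * iteratedDeriv k planckKernel x :=
    (continuous_pow k).mul (continuous_iteratedDeriv_planckKernel k)
  obtain ⟨D, hD⟩ := (isCompact_Icc (a := (0 : ℝ)) (b := 1)).exists_bound_of_continuousOn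
    hcont.continuousOn
  have hD0 : 0 ≤ D := (norm_nonneg _).trans (hD 0 (by simp))
  refine ⟨2 * (C + k.factorial) + 2 * D, by positivity, fun x hx => ?_⟩
  rw [le_div_iff₀ (by positivity)]
  rcases le_total x 1 with h | h
  · have := hD x ⟨hx.le, h⟩
    rw [Real.norm_eq_abs] at this
    have h1 : |x ^ k * iteratedDeriv k planckKernel x| * (1 + x) ≤ D * 2 := by
      gcongr; linarith
    have : (0 : ℝ) ≤ 2 * (C + k.factorial) := by positivity
    linarith
  · have e : x ^ k * iteratedDeriv k planckKernel x
        = (-1) ^ k * (x ^ k * expSum k x - (k.factorial : ℝ) / x) := by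
      rw [iteratedDeriv_planckKernel k hx]
      field_simp
      ring
    have hA := hC x h
    have hA0 : 0 ≤ x ^ k * expSum k x := mul_nonneg (by positivity) (expSum_nonneg k x)
    rw [pow_one] at hA
    have h1 : |x ^ k * iteratedDeriv k planckKernel x| ≤ (C + k.factorial) / x := by
      rw [e, abs_mul, abs_pow, abs_neg, abs_one, one_pow, one_mul, add_div]
      refine (abs_sub _ _).trans ?_
      rw [abs_of_nonneg hA0, abs_of_nonneg (by positivity : (0 : ℝ) ≤ (k.factorial : ℝ) / x)]
      gcongr
    calc |x ^ k * iteratedDeriv k planckKernel x| * (1 + x)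
        ≤ (C + k.factorial) / x * (2 * x) := by gcongr; linarith
      _ = 2 * (C + k.factorial) := by field_simp
      _ ≤ _ := by linarith

lemma integrableOn_Ioi_of_le_inv_sq {u : ℝ → ℝ} (hu : Continuous u) {C : ℝ}
    (h : ∀ x, 1 ≤ x → |u x| ≤ C / x ^ 2) : MeasureTheory.IntegrableOn u (Set.Ioi 0) := by
  rw [← Set.Ioc_union_Ioi_eq_Ioi (zero_le_one' ℝ)]
  refine (hu.integrableOn_Ioc).union ?_
  have hg : MeasureTheory.IntegrableOn (fun x : ℝ => C * x ^ (-2 : ℝ)) (Set.Ioi 1) :=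
    (integrableOn_Ioi_rpow_of_lt (by norm_num) one_pos).const_mul C
  refine MeasureTheory.Integrable.mono' hg hu.aestronglyMeasurable ?_
  filter_upwards [MeasureTheory.ae_restrict_mem measurableSet_Ioi] with x hx
  have hx1 : (1 : ℝ) < x := hx
  rw [Real.norm_eq_abs, Real.rpow_neg (by linarith), ← div_eq_mul_inv]
  simpa using h x hx1.le

open Filter Topology MeasureTheory in
lemma tendsto_pow_mul_expSum (k p : ℕ) :
    Tendsto (fun x => x ^ k * expSum p x) atTop (𝓝 0) := by
  obtain ⟨C, _, hC⟩ := exists_pow_mul_expSum_le k p 1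
  refine squeeze_zero' (g := fun x => C / x ^ 1) ?_ ?_ ?_
  · filter_upwards [eventually_ge_atTop 1] with x hx
    exact mul_nonneg (by positivity) (expSum_nonneg p x)
  · filter_upwards [eventually_ge_atTop 1] with x hx using hC x hx
  · simpa using (tendsto_const_nhds (x := C)).div_atTop tendsto_id

open Filter Topology MeasureTheory in
lemma tendsto_pow_mul_iteratedDeriv (k : ℕ) :
    Tendsto (fun x => x ^ k * iteratedDeriv k planckKernel x) atTop (𝓝 0) := by
  obtain ⟨C, _, hC⟩ := exists_abs_pow_mul_iteratedDeriv_le k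
  refine squeeze_zero_norm' (a := fun x => C / (1 + x)) ?_ ?_
  · filter_upwards [eventually_gt_atTop 0] with x hx using hC x hx
  · exact (tendsto_const_nhds (x := C)).div_atTop (tendsto_atTop_add_const_left _ _ tendsto_id)

open Filter Topology MeasureTheory in
lemma tendsto_pow_succ_mul_iteratedDeriv (k : ℕ) :
    Tendsto (fun x => x ^ (k + 1) * iteratedDeriv k planckKernel x) atTop
      (𝓝 (-((-1) ^ k * (k.factorial : ℝ)))) := by
  have h := ((tendsto_pow_mul_expSum (k + 1) k).sub_const (k.factorial : ℝ)).const_mul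
    ((-1 : ℝ) ^ k)
  rw [zero_sub, mul_neg] at h
  refine h.congr' ?_
  filter_upwards [eventually_gt_atTop 0] with x hx
  rw [iteratedDeriv_planckKernel k hx]
  field_simp

lemma hasDerivAt_pow_mul_iteratedDeriv (n k : ℕ) (x : ℝ) :
    HasDerivAt (fun x => x ^ (n + 1) * iteratedDeriv k planckKernel x)
      ((n + 1) * (x ^ n * iteratedDeriv k planckKernel x)
        + x ^ (n + 1) * iteratedDeriv (k + 1) planckKernel x) x := by
  refine ((hasDerivAt_pow (n + 1) x).mul (hasDerivAt_iteratedDeriv_planckKernel k x)).congr_deriv ?_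
  push_cast
  ring

open MeasureTheory Set in
lemma integrableOn_pow_mul_iteratedDeriv_succ (k : ℕ) :
    IntegrableOn (fun x => x ^ k * iteratedDeriv (k + 1) planckKernel x) (Ioi 0) := by
  obtain ⟨C, hC0, hC⟩ := exists_abs_pow_mul_iteratedDeriv_le (k + 1)
  refine integrableOn_Ioi_of_le_inv_sq (C := C)
    ((continuous_pow k).mul (continuous_iteratedDeriv_planckKernel _)) fun x hx => ?_
  have hx0 : 0 < x := by linarith
  have h := hC x hx0
  rw [pow_succ, mul_right_comm, abs_mul, abs_of_pos hx0] at h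
  have h1 : C / (1 + x) ≤ C / x := by gcongr; linarith
  rw [sq, ← div_div, le_div_iff₀ hx0]
  exact h.trans h1

open MeasureTheory Set in
-- Integration by parts, with boundary terms vanishing for k ≥ 1; the base case is -f(0) = 1/2.
lemma integral_pow_mul_iteratedDeriv_succ (k : ℕ) :
    ∫ x in Ioi (0 : ℝ), x ^ k * iteratedDeriv (k + 1) planckKernel x
      = (-1) ^ k * (k.factorial : ℝ) / 2 := by
  induction k with
  | zero =>
    have h := integral_Ioi_of_hasDerivAt_of_tendsto (a := 0)
      (continuous_iteratedDeriv_planckKernel 0).continuousWithinAt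
      (fun x _ => hasDerivAt_iteratedDeriv_planckKernel 0 x)
      (by simpa using integrableOn_pow_mul_iteratedDeriv_succ 0)
      (by simpa using tendsto_pow_mul_iteratedDeriv 0)
    simp only [pow_zero, one_mul, Nat.factorial_zero, Nat.cast_one]
    rw [h, iteratedDeriv_zero, planckKernel_zero]
    norm_num
  | succ k ih =>
    have i1 := (integrableOn_pow_mul_iteratedDeriv_succ k).const_mul ((k : ℝ) + 1)
    have i2 := integrableOn_pow_mul_iteratedDeriv_succ (k + 1)
    have h := integral_Ioi_of_hasDerivAt_of_tendsto (a := 0)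
      ((continuous_pow (k + 1)).mul
        (continuous_iteratedDeriv_planckKernel (k + 1))).continuousWithinAt
      (fun x _ => hasDerivAt_pow_mul_iteratedDeriv k (k + 1) x)
      (i1.add i2) (tendsto_pow_mul_iteratedDeriv (k + 1))
    rw [integral_add i1 i2, integral_const_mul, ih] at h
    have h0 : ((fun a : ℝ => a ^ (k + 1)) * iteratedDeriv (k + 1) planckKernel) 0 = 0 := by simp
    rw [h0, sub_zero] at h
    rw [Nat.factorial_succ, pow_succ]
    push_cast
    linear_combination h

open MeasureTheory Set in
lemma integrableOn_pow_mul_iteratedDeriv_add (k : ℕ) :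
    IntegrableOn (fun x => ((k : ℝ) + 1) * (x ^ k * iteratedDeriv k planckKernel x)
      + x ^ (k + 1) * iteratedDeriv (k + 1) planckKernel x) (Ioi 0) := by
  obtain ⟨C, hC0, hC⟩ := exists_pow_mul_expSum_le k k 2
  obtain ⟨D, hD0, hD⟩ := exists_pow_mul_expSum_le (k + 1) (k + 1) 2
  refine integrableOn_Ioi_of_le_inv_sq (C := (k + 1) * C + D)
    (((continuous_pow k).mul (continuous_iteratedDeriv_planckKernel _)).const_mul _ |>.add
      ((continuous_pow _).mul (continuous_iteratedDeriv_planckKernel _))) fun x hx => ?_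
  have hx0 : 0 < x := by linarith
  have e : ((k : ℝ) + 1) * (x ^ k * iteratedDeriv k planckKernel x)
      + x ^ (k + 1) * iteratedDeriv (k + 1) planckKernel x
      = (-1) ^ k * ((k + 1) * (x ^ k * expSum k x) - x ^ (k + 1) * expSum (k + 1) x) := by
    rw [iteratedDeriv_planckKernel _ hx0, iteratedDeriv_planckKernel _ hx0, Nat.factorial_succ,
      pow_succ (-1 : ℝ)]
    push_cast
    field_simp
    ring
  have h1 : 0 ≤ x ^ k * expSum k x := mul_nonneg (by positivity) (expSum_nonneg k x)
  have h2 : 0 ≤ x ^ (k + 1) * expSum (k + 1) x :=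
    mul_nonneg (by positivity) (expSum_nonneg _ x)
  rw [e, abs_mul, abs_pow, abs_neg, abs_one, one_pow, one_mul, add_div, mul_div_assoc]
  refine (abs_sub _ _).trans ?_
  rw [abs_of_nonneg h2, abs_of_nonneg (by positivity)]
  gcongr
  · exact hC x hx
  · exact hD x hx

open MeasureTheory Set in
lemma integral_pow_mul_iteratedDeriv_add (k : ℕ) :
    ∫ x in Ioi (0 : ℝ), (((k : ℝ) + 1) * (x ^ k * iteratedDeriv k planckKernel x)
      + x ^ (k + 1) * iteratedDeriv (k + 1) planckKernel x)
      = -((-1) ^ k * (k.factorial : ℝ)) := by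
  have h := integral_Ioi_of_hasDerivAt_of_tendsto (a := 0)
    ((continuous_pow (k + 1)).mul
      (continuous_iteratedDeriv_planckKernel k)).continuousWithinAt
    (fun x _ => hasDerivAt_pow_mul_iteratedDeriv k k x)
    (integrableOn_pow_mul_iteratedDeriv_add k) (tendsto_pow_succ_mul_iteratedDeriv k)
  rw [h]
  simp

open MeasureTheory Set in
-- Neither term alone is integrable, as f has the tail -1/x, but the tails cancel. Raising k by one
-- adds a multiple of (x^{k+1} f⁽ᵏ⁾)', whose integral contributes -1/(k+1).
lemma integral_planckKernel_sub (k : ℕ) :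
    IntegrableOn (fun x => planckKernel x
      - (-1) ^ k / (k.factorial : ℝ) * (x ^ k * iteratedDeriv k planckKernel x)) (Ioi 0) ∧
    ∫ x in Ioi (0 : ℝ), (planckKernel x
      - (-1) ^ k / (k.factorial : ℝ) * (x ^ k * iteratedDeriv k planckKernel x))
      = -((harmonic k : ℚ) : ℝ) := by
  induction k with
  | zero => simp
  | succ k ih =>
    have e : (fun x => planckKernel x - (-1) ^ (k + 1) / ((k + 1).factorial : ℝ)
          * (x ^ (k + 1) * iteratedDeriv (k + 1) planckKernel x))
        = fun x => (planckKernel x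
          - (-1) ^ k / (k.factorial : ℝ) * (x ^ k * iteratedDeriv k planckKernel x))
          + (-1) ^ k / ((k + 1).factorial : ℝ)
            * (((k : ℝ) + 1) * (x ^ k * iteratedDeriv k planckKernel x)
              + x ^ (k + 1) * iteratedDeriv (k + 1) planckKernel x) := by
      funext x
      rw [Nat.factorial_succ]
      push_cast
      field_simp
      ring
    have i2 := (integrableOn_pow_mul_iteratedDeriv_add k).const_mul
      ((-1) ^ k / ((k + 1).factorial : ℝ))
    simp only [e]
    refine ⟨ih.1.add i2, ?_⟩
    rw [integral_add ih.1 i2, integral_const_mul, integral_pow_mul_iteratedDeriv_add, ih.2,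
      harmonic_succ, Nat.factorial_succ]
    push_cast
    have h1 : ((-1 : ℝ) ^ k) * (-1) ^ k = 1 := by rw [← mul_pow]; simp
    have h2 : (k.factorial : ℝ) ≠ 0 := by positivity
    field_simp
    linear_combination (-1 : ℝ) * h1

/-! ### The integrals Lₖ = ∫ xᵏ f f⁽ᵏ⁾. -/

/-- The regularised integrand `(f(x) - f(0))/x + f(x)/2` for `f = planckKernel`. -/
noncomputable def binetIntegrand (x : ℝ) : ℝ := dslope planckKernel 0 x + planckKernel x / 2

lemma binetIntegrand_of_pos {x : ℝ} (hx : 0 < x) :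
    binetIntegrand x = expSum 0 x / x + expSum 0 x / 2 - 1 / x ^ 2 := by
  rw [binetIntegrand, dslope_of_ne _ hx.ne', slope_def_field, planckKernel_of_pos hx,
    planckKernel_zero, sub_zero]
  field_simp
  ring

open MeasureTheory Set in
lemma integrableOn_binetIntegrand : IntegrableOn binetIntegrand (Ioi 0) := by
  obtain ⟨C, hC0, hC⟩ := exists_pow_mul_expSum_le 0 0 2
  have hc : Continuous binetIntegrand := by
    have h1 : Continuous planckKernel := contDiff_planckKernel (n := 0).continuous
    have h2 : Continuous (dslope planckKernel 0) := continuous_iff_continuousAt.mpr fun x =>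
      (analyticAt_dslope analyticAt_planckKernel 0 x).continuousAt
    exact h2.add (h1.div_const 2)
  refine integrableOn_Ioi_of_le_inv_sq (C := C + C + 1) hc fun x hx => ?_
  have hx0 : 0 < x := by linarith
  have h := hC x hx
  rw [pow_zero, one_mul] at h
  have h0 := expSum_nonneg 0 x
  have h1 : expSum 0 x / x ≤ C / x ^ 2 := (div_le_self h0 hx).trans h
  have h2 : expSum 0 x / 2 ≤ C / x ^ 2 := (div_le_self h0 (by norm_num)).trans h
  rw [binetIntegrand_of_pos hx0, add_div, add_div]
  refine (abs_sub _ _).trans ?_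
  rw [abs_of_nonneg (by positivity), abs_of_nonneg (by positivity)]
  gcongr

/-- Replaces the Faulhaber product at k = 0, where the convention 0⁰ = 1 breaks the convolution
formula. -/
lemma expSum_zero_sq {x : ℝ} (hx : 0 < x) : expSum 0 x ^ 2 = expSum 1 x - expSum 0 x := by
  have h2 : 1 < Real.exp x := by simpa using hx
  have h3 : Real.exp x - 1 ≠ 0 := by linarith
  have h := hasDerivAt_expSum 0 hx
  have h' : HasDerivAt (expSum 0) (-Real.exp x / (Real.exp x - 1) ^ 2) x := by
    refine HasDerivAt.congr_of_eventuallyEq (((Real.hasDerivAt_exp x).sub_const 1).inv h3) ?_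
    filter_upwards [Ioi_mem_nhds hx] with y hy using expSum_zero hy
  have e := h.unique h'
  have e1 : expSum 1 x = Real.exp x / (Real.exp x - 1) ^ 2 := by
    rw [neg_div] at e; simpa using e
  rw [e1, expSum_zero hx]
  field_simp
  ring

open MeasureTheory Set in
lemma integral_planckKernel_sq :
    ∫ x in Ioi (0 : ℝ), x ^ 0 * (planckKernel x * iteratedDeriv 0 planckKernel x)
      = -1 / 2 - 2 * ∫ x in Ioi (0 : ℝ), binetIntegrand x := by
  have e : ∀ x ∈ Ioi (0 : ℝ), x ^ 0 * (planckKernel x * iteratedDeriv 0 planckKernel x)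
      = (-1) * (x ^ 0 * iteratedDeriv (0 + 1) planckKernel x) + (-2) * binetIntegrand x := by
    intro x hx
    have hx0 : 0 < x := hx
    rw [iteratedDeriv_zero, iteratedDeriv_planckKernel _ hx0, binetIntegrand_of_pos hx0,
      planckKernel_of_pos hx0]
    have h := expSum_zero_sq hx0
    simp only [Nat.factorial, zero_add]
    field_simp
    push_cast
    linear_combination (x ^ 4) * h
  rw [setIntegral_congr_fun measurableSet_Ioi e,
    integral_add ((integrableOn_pow_mul_iteratedDeriv_succ 0).const_mul _)
      (integrableOn_binetIntegrand.const_mul _), integral_const_mul, integral_const_mul,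
    integral_pow_mul_iteratedDeriv_succ]
  norm_num
  ring

/-- Groups the product so that every summand is integrable: the 1/x tails are paired inside
`binetIntegrand` and inside the difference f - (-1)ᵏ xᵏ f⁽ᵏ⁾/k!. -/
lemma pow_mul_planckKernel_mul {k l : ℕ} (hl : k = l + 1) {x : ℝ} (hx : 0 < x) :
    x ^ k * (planckKernel x * iteratedDeriv k planckKernel x)
      = ((-1 / (k + 1)) * (x ^ k * iteratedDeriv (k + 1) planckKernel x)
        + (-1) * (x ^ l * iteratedDeriv (l + 1) planckKernel x)
        + (-((-1) ^ k * (k.factorial : ℝ))) * binetIntegrand x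
        + ((-1) ^ k * (k.factorial : ℝ) / 2) * (planckKernel x
          - (-1) ^ k / (k.factorial : ℝ) * (x ^ k * iteratedDeriv k planckKernel x)))
        + ∑ r ∈ Finset.Icc 2 k, ((-1) ^ k * (((bernoulli r : ℚ) : ℝ) * ((k + 1).choose r : ℝ)
            / (k + 1))) * (x ^ k * expSum (k + 1 - r) x) := by
  have hprod := expSum_zero_mul k hx (by omega)
  -- The terms r = 0 and r = 1, with B₀ = 1 and B₁ = -1/2, are split off: they involve E_{k+1} and
  -- Eₖ, whose integrals against xᵏ diverge.
  rw [Finset.range_eq_Ico, Finset.sum_eq_sum_Ico_succ_bot (by omega),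
    Finset.sum_eq_sum_Ico_succ_bot (by omega)] at hprod
  have hI : Finset.Ico (0 + 1 + 1) (k + 1) = Finset.Icc 2 k := by
    ext i; simp only [Finset.mem_Ico, Finset.mem_Icc]; omega
  rw [hI] at hprod
  have hS : ∑ r ∈ Finset.Icc 2 k, ((-1) ^ k * (((bernoulli r : ℚ) : ℝ) * ((k + 1).choose r : ℝ)
          / (k + 1))) * (x ^ k * expSum (k + 1 - r) x)
      = (-1) ^ k * x ^ k * ∑ r ∈ Finset.Icc 2 k, ((bernoulli r : ℚ) : ℝ)
        * ((k + 1).choose r : ℝ) / (k + 1) * expSum (k + 1 - r) x := by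
    rw [Finset.mul_sum]
    exact Finset.sum_congr rfl fun r _ => by ring
  rw [hS]
  generalize ∑ r ∈ Finset.Icc 2 k, ((bernoulli r : ℚ) : ℝ)
    * ((k + 1).choose r : ℝ) / (k + 1) * expSum (k + 1 - r) x = S at hprod
  have hk1 : (k : ℝ) + 1 ≠ 0 := by positivity
  have hS' : S = expSum 0 x * expSum k x - expSum (k + 1) x / (k + 1) + expSum k x / 2 := by
    rw [hprod]
    simp
    field_simp
    ring
  have hs : ((-1 : ℝ) ^ k) * (-1) ^ k = 1 := by rw [← mul_pow]; simp
  have hF : (k.factorial : ℝ) ≠ 0 := by positivity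
  have hxk : x ^ k = x ^ l * x := by rw [hl, pow_succ]
  have hx0 : x ≠ 0 := hx.ne'
  have hxl : x ^ l ≠ 0 := by positivity
  rw [hS', ← hl, iteratedDeriv_planckKernel _ hx, iteratedDeriv_planckKernel _ hx,
    binetIntegrand_of_pos hx, planckKernel_of_pos hx, Nat.factorial_succ, pow_succ (-1 : ℝ) k,
    pow_succ x (k + 1), pow_succ x k, hxk]
  push_cast
  generalize (-1 : ℝ) ^ k = s at *
  generalize (k.factorial : ℝ) = F at *
  generalize x ^ l = y at *
  generalize expSum 0 x = a
  generalize expSum k x = b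
  generalize expSum (k + 1) x = c
  have h3 : s * F / 2 * (a - 1 / x - s / F * (y * x * (s * (b - F / (y * x * x)))))
      = s * F / 2 * (a - 1 / x) - (s * s) * (s / 2 * (y * x * (b - F / (y * x * x)))) := by
    field_simp
  rw [h3, hs]
  field_simp
  ring

open MeasureTheory Set in
lemma integral_pow_mul_planckKernel_mul {k : ℕ} (hk : 1 ≤ k) :
    ∫ x in Ioi (0 : ℝ), x ^ k * (planckKernel x * iteratedDeriv k planckKernel x)
      = momentTerm (∫ x in Ioi (0 : ℝ), binetIntegrand x)
          (fun r => zetaReal r * ((bernoulli r : ℚ) : ℝ)) k := by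
  obtain ⟨l, hl⟩ : ∃ l, k = l + 1 := ⟨k - 1, by omega⟩
  have hz : ∀ r ∈ Finset.Icc 2 k,
      IntegrableOn (fun x => x ^ k * expSum (k + 1 - r) x) (Ioi 0) ∧
      ∫ x in Ioi (0 : ℝ), x ^ k * expSum (k + 1 - r) x = k.factorial * zetaReal r := by
    intro r hr
    rw [Finset.mem_Icc] at hr
    exact integral_pow_mul_expSum hr.1 (by omega)
  have hadd : ∀ {a b c d e : ℝ → ℝ}, IntegrableOn a (Ioi 0) → IntegrableOn b (Ioi 0) →
      IntegrableOn c (Ioi 0) → IntegrableOn d (Ioi 0) → IntegrableOn e (Ioi 0) →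
      ∫ x in Ioi (0 : ℝ), a x + b x + c x + d x + e x = (∫ x in Ioi (0 : ℝ), a x)
        + (∫ x in Ioi (0 : ℝ), b x) + (∫ x in Ioi (0 : ℝ), c x) + (∫ x in Ioi (0 : ℝ), d x)
        + ∫ x in Ioi (0 : ℝ), e x := by
    intro a b c d e ha hb hc hd he
    rw [← integral_add' ha hb, ← integral_add' (ha.add hb) hc,
      ← integral_add' ((ha.add hb).add hc) hd, ← integral_add' (((ha.add hb).add hc).add hd) he]
    rfl
  have i1 := (integrableOn_pow_mul_iteratedDeriv_succ k).const_mul (-1 / ((k : ℝ) + 1))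
  have i2 := (integrableOn_pow_mul_iteratedDeriv_succ l).const_mul (-1 : ℝ)
  have i3 := integrableOn_binetIntegrand.const_mul (-((-1) ^ k * (k.factorial : ℝ)))
  have i4 := (integral_planckKernel_sub k).1.const_mul ((-1) ^ k * (k.factorial : ℝ) / 2)
  have i5 : ∀ r ∈ Finset.Icc 2 k, IntegrableOn (fun x => ((-1) ^ k * (((bernoulli r : ℚ) : ℝ)
      * ((k + 1).choose r : ℝ) / (k + 1))) * (x ^ k * expSum (k + 1 - r) x)) (Ioi 0) :=
    fun r hr => (hz r hr).1.const_mul _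
  rw [setIntegral_congr_fun measurableSet_Ioi fun x hx => pow_mul_planckKernel_mul hl hx]
  refine (hadd i1 i2 i3 i4 (integrable_finsetSum _ i5)).trans ?_
  rw [integral_finsetSum _ i5]
  simp only [integral_const_mul]
  rw [integral_pow_mul_iteratedDeriv_succ, integral_pow_mul_iteratedDeriv_succ,
    (integral_planckKernel_sub k).2, Finset.sum_congr rfl fun r hr => by rw [(hz r hr).2],
    momentTerm, mul_add, Finset.mul_sum]
  congr 1
  · rw [hl, Nat.factorial_succ, pow_succ]
    push_cast
    have h1 : (l : ℝ) + 1 ≠ 0 := by positivity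
    have h2 : (l : ℝ) + 1 + 1 ≠ 0 := by positivity
    field_simp
    ring
  · exact Finset.sum_congr rfl fun r _ => by ring

/-! ### Mellin transforms and the constant q. -/

lemma hasMellin_exp_neg {s : ℂ} (hs : 0 < s.re) :
    HasMellin (fun x : ℝ => (Real.exp (-x) : ℂ)) s (Complex.Gamma s) := by
  constructor
  · refine (Complex.GammaIntegral_convergent hs).congr (Filter.Eventually.of_forall fun x => ?_)
    simp only [smul_eq_mul]
    rw [mul_comm]
  · rw [Complex.Gamma_eq_integral hs, Complex.GammaIntegral_eq_mellin]

lemma hasMellin_exp_neg_div {s : ℂ} (hs : 1 < s.re) :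
    HasMellin (fun x : ℝ => (x : ℂ) ^ (-1 : ℂ) • (Real.exp (-x) : ℂ)) s
      (Complex.Gamma (s - 1)) := by
  have h := hasMellin_exp_neg (s := s + -1) (by simp; linarith)
  exact ⟨MellinConvergent.cpow_smul.mpr h.1, by rw [mellin_cpow_smul, h.2, sub_eq_add_neg]⟩

lemma mellin_expSum_zero {s : ℂ} (hs : 1 < s.re) :
    mellin (fun x => (expSum 0 x : ℂ)) s = Complex.Gamma s * riemannZeta s := by
  have h := hasSum_mellin (ι := ℕ) (a := fun _ => 1) (p := fun i => (i : ℝ) + 1)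
    (F := fun x => (expSum 0 x : ℂ)) (s := s) (fun i => Or.inr (by positivity)) (by linarith)
    (fun t ht => ?_) ?_
  · rw [← h.tsum_eq, zeta_eq_tsum_one_div_nat_add_one_cpow hs, ← tsum_mul_left]
    refine tsum_congr fun i => ?_
    push_cast
    ring
  · have h1 := (summable_expSum 0 ht).hasSum
    have h2 := Complex.hasSum_ofReal.mpr h1
    simpa [expSum] using h2
  · have h1 := (summable_nat_add_iff 1).mpr (Real.summable_one_div_nat_rpow.mpr hs)
    refine h1.congr fun i => ?_
    push_cast
    simp

/-- The analytic function equal to `1/(eˣ-1) - e⁻ˣ (1/x + 1/2)` for `x > 0`, which vanishes at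
`0`. -/
noncomputable def binetRemainder (x : ℝ) : ℝ :=
  planckKernel x - dslope (fun y => Real.exp (-y)) 0 x - Real.exp (-x) / 2

lemma analyticAt_dslope_exp_neg (x : ℝ) :
    AnalyticAt ℝ (dslope (fun y : ℝ => Real.exp (-y)) 0) x :=
  analyticAt_dslope (fun _ => analyticAt_id.neg.rexp) 0 x

lemma dslope_exp_neg_zero : dslope (fun y : ℝ => Real.exp (-y)) 0 0 = -1 := by
  rw [dslope_same]
  have h := (hasDerivAt_neg (0 : ℝ)).exp
  simpa using h.deriv

lemma dslope_exp_neg_of_pos {x : ℝ} (hx : 0 < x) :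
    dslope (fun y : ℝ => Real.exp (-y)) 0 x = (Real.exp (-x) - 1) / x := by
  rw [dslope_of_ne _ hx.ne', slope_def_field]
  simp

lemma analyticAt_binetRemainder (x : ℝ) : AnalyticAt ℝ binetRemainder x :=
  ((analyticAt_planckKernel x).sub (analyticAt_dslope_exp_neg x)).sub
    (analyticAt_id.neg.rexp.div_const)

lemma continuous_binetRemainder : Continuous binetRemainder :=
  continuous_iff_continuousAt.mpr fun x => (analyticAt_binetRemainder x).continuousAt

lemma binetRemainder_of_pos {x : ℝ} (hx : 0 < x) :
    binetRemainder x = expSum 0 x - Real.exp (-x) * (1 / x + 1 / 2) := by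
  rw [binetRemainder, planckKernel_of_pos hx, dslope_exp_neg_of_pos hx]
  field_simp
  ring

lemma binetRemainder_zero : binetRemainder 0 = 0 := by
  rw [binetRemainder, planckKernel_zero, dslope_exp_neg_zero]
  norm_num

open Asymptotics Filter Topology in
lemma binetRemainder_isBigO_zero :
    (fun x => (binetRemainder x : ℂ)) =O[𝓝[>] 0] fun x : ℝ => x ^ (-(-1) : ℝ) := by
  have h := (analyticAt_binetRemainder 0).differentiableAt.isBigO_sub
  simp only [binetRemainder_zero, sub_zero] at h
  have h1 : (fun x => (binetRemainder x : ℂ)) =O[𝓝 0] fun x : ℝ => x ^ (-(-1) : ℝ) := by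
    simpa [← isBigO_norm_left] using h
  exact h1.mono nhdsWithin_le_nhds

open Asymptotics Filter Topology in
lemma expSum_zero_isBigO_atTop :
    (fun x => (expSum 0 x : ℂ)) =O[atTop] fun x : ℝ => Real.exp (-1 * x) := by
  refine IsBigO.of_bound (Real.exp 1 * expSum 0 1) ?_
  filter_upwards [eventually_ge_atTop 1] with x hx
  have h := expSum_le 0 hx
  rw [Complex.norm_real, Real.norm_of_nonneg (expSum_nonneg 0 x),
    Real.norm_of_nonneg (Real.exp_pos _).le, neg_one_mul]
  exact h

open Asymptotics Filter Topology in
lemma binetRemainder_isBigO_atTop :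
    (fun x => (binetRemainder x : ℂ)) =O[atTop] fun x : ℝ => Real.exp (-1 * x) := by
  have h2 : (fun x : ℝ => ((Real.exp (-x) * (1 / x + 1 / 2) : ℝ) : ℂ)) =O[atTop]
      fun x : ℝ => Real.exp (-1 * x) := by
    refine IsBigO.of_bound 2 ?_
    filter_upwards [eventually_ge_atTop 1] with x hx
    have h1 : 1 / x ≤ 1 := by rw [div_le_one (by linarith)]; exact hx
    have h0 : 0 < 1 / x := by positivity
    rw [Complex.norm_real, Real.norm_of_nonneg (by positivity),
      Real.norm_of_nonneg (Real.exp_pos _).le, neg_one_mul, mul_comm]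
    gcongr
    linarith
  refine (expSum_zero_isBigO_atTop.sub h2).congr' ?_ EventuallyEq.rfl
  filter_upwards [eventually_gt_atTop 0] with x hx
  rw [binetRemainder_of_pos hx]
  push_cast
  ring

lemma locallyIntegrableOn_binetRemainder :
    MeasureTheory.LocallyIntegrableOn (fun x => (binetRemainder x : ℂ)) (Set.Ioi 0) :=
  (Complex.continuous_ofReal.comp continuous_binetRemainder).locallyIntegrable.locallyIntegrableOn _

lemma mellinConvergent_binetRemainder {s : ℂ} (hs : -1 < s.re) :
    MellinConvergent (fun x => (binetRemainder x : ℂ)) s :=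
  mellinConvergent_of_isBigO_rpow_exp one_pos locallyIntegrableOn_binetRemainder
    binetRemainder_isBigO_atTop binetRemainder_isBigO_zero hs

lemma differentiableAt_mellin_binetRemainder {s : ℂ} (hs : -1 < s.re) :
    DifferentiableAt ℂ (mellin fun x => (binetRemainder x : ℂ)) s :=
  mellin_differentiableAt_of_isBigO_rpow_exp one_pos locallyIntegrableOn_binetRemainder
    binetRemainder_isBigO_atTop binetRemainder_isBigO_zero hs

lemma mellin_binetRemainder_of_one_lt {s : ℂ} (hs : 1 < s.re) :
    mellin (fun x => (binetRemainder x : ℂ)) s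
      = Complex.Gamma s * riemannZeta s - Complex.Gamma (s - 1) - Complex.Gamma s / 2 := by
  have h0 := mellinConvergent_binetRemainder (s := s) (by linarith)
  have h1 := hasMellin_exp_neg_div hs
  have h2 := (hasMellin_exp_neg (s := s) (by linarith)).1.const_smul (1 / 2 : ℂ)
  have h3 := (hasMellin_exp_neg (s := s) (by linarith)).2
  have e := hasMellin_add h0 (hasMellin_add h1.1 h2).1
  have e2 : mellin (fun x => (expSum 0 x : ℂ)) s = mellin (fun x => (binetRemainder x : ℂ)) s
      + mellin (fun x : ℝ => (x : ℂ) ^ (-1 : ℂ) • (Real.exp (-x) : ℂ)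
        + (1 / 2 : ℂ) • (Real.exp (-x) : ℂ)) s := by
    rw [← e.2]
    refine MeasureTheory.setIntegral_congr_fun measurableSet_Ioi fun x hx => ?_
    simp only
    congr 1
    rw [binetRemainder_of_pos hx, Complex.cpow_neg_one]
    push_cast
    simp only [smul_eq_mul]
    ring
  rw [mellin_expSum_zero hs, (hasMellin_add h1.1 h2).2, h1.2, mellin_const_smul, h3] at e2
  rw [e2]
  simp only [smul_eq_mul]
  ring

/-- The factor s(s - 1) clears the poles, so both sides are analytic on Re s > -1. They agree near s
= 2, hence everywhere by the identity theorem. Here `riemannZeta₁` is the entire function (s -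
1)ζ(s). -/
lemma mul_mellin_binetRemainder {s : ℂ} (hs : -1 < s.re) :
    s * (s - 1) * mellin (fun x => (binetRemainder x : ℂ)) s
      = Complex.Gamma (s + 1) * (riemannZeta₁ s - 1 - (s - 1) / 2) := by
  have hU : IsOpen {z : ℂ | -1 < z.re} := isOpen_lt continuous_const Complex.continuous_re
  have hf : AnalyticOnNhd ℂ (fun s => s * (s - 1) * mellin (fun x => (binetRemainder x : ℂ)) s)
      {z : ℂ | -1 < z.re} := by
    refine DifferentiableOn.analyticOnNhd (fun z hz => ?_) hU
    have := differentiableAt_mellin_binetRemainder hz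
    exact (((differentiableAt_id.mul (differentiableAt_id.sub_const 1))).mul
      this).differentiableWithinAt
  have hg : AnalyticOnNhd ℂ (fun s => Complex.Gamma (s + 1) * (riemannZeta₁ s - 1 - (s - 1) / 2))
      {z : ℂ | -1 < z.re} := by
    refine DifferentiableOn.analyticOnNhd (fun z hz => ?_) hU
    have h1 : DifferentiableAt ℂ (fun s => Complex.Gamma (s + 1)) z := by
      refine (Complex.differentiableAt_Gamma (z + 1) fun m hm => ?_).comp z
        (differentiableAt_id.add_const 1)
      have h2 := congrArg Complex.re hm
      have h3 : -1 < z.re := hz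
      have h4 : (0 : ℝ) ≤ m := by positivity
      simp at h2
      linarith
    have h2 : DifferentiableAt ℂ (fun s => riemannZeta₁ s - 1 - (s - 1) / 2) z := by fun_prop
    exact (h1.mul h2).differentiableWithinAt
  refine hf.eqOn_of_preconnected_of_eventuallyEq hg
    (convex_halfSpace_re_gt (-1)).isPreconnected (z₀ := 2) (by simp; norm_num) ?_ hs
  have h2 : {z : ℂ | 1 < z.re} ∈ nhds (2 : ℂ) :=
    (isOpen_lt continuous_const Complex.continuous_re).mem_nhds (by simp)
  filter_upwards [h2] with z hz
  have hz' : 1 < z.re := hz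
  have hz0 : z ≠ 0 := fun h => by simp [h] at hz'; linarith
  have hz1 : z - 1 ≠ 0 := fun h => by
    rw [sub_eq_zero] at h; simp [h] at hz'
  rw [mellin_binetRemainder_of_one_lt hz', Complex.Gamma_add_one z hz0,
    riemannZeta_eq_inv_sub_mul (sub_ne_zero.mp hz1)]
  have h3 : Complex.Gamma z = (z - 1) * Complex.Gamma (z - 1) := by
    have := Complex.Gamma_add_one (z - 1) hz1
    rwa [sub_add_cancel] at this
  rw [h3]
  field_simp

lemma mellin_binetRemainder_of_mem_strip {s : ℂ} (h0 : 0 < s.re) (h1 : s.re < 1) :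
    mellin (fun x => (binetRemainder x : ℂ)) s
      = Complex.Gamma s * riemannZeta s - Complex.Gamma s / (s - 1) - Complex.Gamma s / 2 := by
  have h := mul_mellin_binetRemainder (s := s) (by linarith)
  have hz0 : s ≠ 0 := fun h => by simp [h] at h0
  have hz1 : s - 1 ≠ 0 := fun h => by
    rw [sub_eq_zero] at h; simp [h] at h1
  rw [Complex.Gamma_add_one s hz0] at h
  rw [riemannZeta_eq_inv_sub_mul (sub_ne_zero.mp hz1)]
  have h2 : s * (s - 1) ≠ 0 := mul_ne_zero hz0 hz1
  rw [← mul_right_inj' h2, h]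
  field_simp

/-- Used at a = 0 and a = 1, where s(s - 1) vanishes and the identity itself says nothing about the
Mellin transform; its derivative does. By `h0` the term with Γ' drops out. -/
lemma hasDerivAt_Gamma_succ_mul {a : ℂ} (ha : -1 < a.re) (h0 : riemannZeta₁ a - 1 - (a - 1) / 2 = 0)
    {d : ℂ} (hd : HasDerivAt riemannZeta₁ d a) :
    (2 * a - 1) * mellin (fun x => (binetRemainder x : ℂ)) a
      + a * (a - 1) * deriv (mellin fun x => (binetRemainder x : ℂ)) a
      = Complex.Gamma (a + 1) * (d - 1 / 2) := by
  have hU : IsOpen {z : ℂ | -1 < z.re} := isOpen_lt continuous_const Complex.continuous_re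
  have hL := ((hasDerivAt_id a).mul ((hasDerivAt_id a).sub_const 1)).mul
    (differentiableAt_mellin_binetRemainder ha).hasDerivAt
  have hG : DifferentiableAt ℂ (fun s => Complex.Gamma (s + 1)) a := by
    refine (Complex.differentiableAt_Gamma (a + 1) fun m hm => ?_).comp a
      (differentiableAt_id.add_const 1)
    have h2 := congrArg Complex.re hm
    have h4 : (0 : ℝ) ≤ m := by positivity
    simp at h2
    linarith
  have hR := hG.hasDerivAt.mul ((hd.sub_const 1).sub (((hasDerivAt_id a).sub_const 1).div_const 2))
  have hL' := hL.congr_of_eventuallyEq (f₁ := fun s => Complex.Gamma (s + 1)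
      * (riemannZeta₁ s - 1 - (s - 1) / 2)) (by
    filter_upwards [hU.mem_nhds ha] with z hz
    exact (mul_mellin_binetRemainder hz).symm)
  have h := hL'.unique hR
  simp only [Pi.mul_apply, Pi.sub_apply, id_eq] at h
  rw [h0, mul_zero, zero_add] at h
  rw [← h]
  ring

lemma mellin_binetRemainder_one :
    mellin (fun x => (binetRemainder x : ℂ)) 1 = (Real.eulerMascheroniConstant : ℂ) - 1 / 2 := by
  have hd : HasDerivAt riemannZeta₁ (Real.eulerMascheroniConstant : ℂ) 1 := by
    rw [← deriv_riemannZeta₁_one]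
    exact (differentiable_riemannZeta₁ 1).hasDerivAt
  have h := hasDerivAt_Gamma_succ_mul (a := 1) (by simp) (by simp) hd
  rw [show (1 : ℂ) + 1 = (1 : ℕ) + 1 by norm_num, Complex.Gamma_nat_eq_factorial] at h
  simp at h
  linear_combination h

lemma mellin_binetRemainder_zero :
    mellin (fun x => (binetRemainder x : ℂ)) 0 = 1 - Real.log (2 * Real.pi) / 2 := by
  have hz : HasDerivAt riemannZeta (-Real.log (2 * Real.pi) / 2 : ℂ) 0 := by
    have := (differentiableAt_riemannZeta (s := 0) (by norm_num)).hasDerivAt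
    rw [deriv_riemannZeta_zero] at this
    rw [Complex.ofReal_log (by positivity)]
    push_cast
    exact this
  have hd : HasDerivAt riemannZeta₁ (riemannZeta 0
      + (0 - 1) * (-Real.log (2 * Real.pi) / 2 : ℂ)) 0 := by
    have h1 := ((hasDerivAt_id (0 : ℂ)).sub_const 1).mul hz
    simp only [id, one_mul] at h1
    refine h1.congr_of_eventuallyEq ?_
    filter_upwards [isOpen_ne.mem_nhds (show (0 : ℂ) ≠ 1 by norm_num)] with z hz
    have : z - 1 ≠ 0 := sub_ne_zero.mpr hz
    simp only [Pi.mul_apply]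
    rw [riemannZeta_eq_inv_sub_mul hz]
    field_simp
  have h1 : riemannZeta₁ 0 = 1 / 2 := by
    have := riemannZeta_eq_inv_sub_mul (s := 0) (by norm_num)
    rw [riemannZeta_zero] at this
    norm_num at this
    rw [← this]
  have h := hasDerivAt_Gamma_succ_mul (a := 0) (by simp) (by rw [h1]; norm_num) hd
  rw [riemannZeta_zero] at h
  simp at h
  linear_combination (-1 : ℂ) * h

open MeasureTheory Set Filter Topology in
lemma integral_binetIntegrand :
    ∫ x in Ioi (0 : ℝ), binetIntegrand x
      = -(Real.log (2 * Real.pi) - Real.eulerMascheroniConstant) / 2 := by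
  have c0 := mellinConvergent_binetRemainder (s := 0) (by simp)
  have c1 := mellinConvergent_binetRemainder (s := 1) (by simp)
  have e0 : ∀ x : ℝ, (x : ℂ) ^ ((0 : ℂ) - 1) • (binetRemainder x : ℂ)
      = ((binetRemainder x / x : ℝ) : ℂ) := by
    intro x
    rw [zero_sub, Complex.cpow_neg_one, smul_eq_mul]
    push_cast
    ring
  have e1 : ∀ x : ℝ, (x : ℂ) ^ ((1 : ℂ) - 1) • (binetRemainder x : ℂ)
      = ((binetRemainder x : ℝ) : ℂ) := by
    intro x
    simp
  have m0 := mellin_binetRemainder_zero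
  have m1 := mellin_binetRemainder_one
  rw [MellinConvergent] at c0 c1
  rw [mellin] at m0 m1
  simp only [e0] at c0 m0
  simp only [e1] at c1 m1
  have i0 : IntegrableOn (fun x => binetRemainder x / x) (Ioi 0) := by
    simpa [IntegrableOn] using c0.re
  have i1 : IntegrableOn (fun x => binetRemainder x) (Ioi 0) := by
    simpa [IntegrableOn] using c1.re
  rw [integral_complex_ofReal] at m0 m1
  have v0 : ∫ x in Ioi (0 : ℝ), binetRemainder x / x = 1 - Real.log (2 * Real.pi) / 2 := by
    exact_mod_cast m0
  have v1 : ∫ x in Ioi (0 : ℝ), binetRemainder x = Real.eulerMascheroniConstant - 1 / 2 := by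
    have : ((∫ x in Ioi (0 : ℝ), binetRemainder x : ℝ) : ℂ)
        = ((Real.eulerMascheroniConstant - 1 / 2 : ℝ) : ℂ) := by rw [m1]; push_cast; ring
    exact_mod_cast this
  -- With R = `binetRemainder`, β is chosen so that `binetIntegrand` = R/x + R/2 + β'. Hence q is
  -- the Mellin value at 0, plus half the value at 1, minus β(0) = 3/4.
  set β : ℝ → ℝ := fun x => -dslope (fun y : ℝ => Real.exp (-y)) 0 x - Real.exp (-x) / 4 with hβ
  have hβc : Continuous β := continuous_iff_continuousAt.mpr fun x =>
    ((analyticAt_dslope_exp_neg x).neg.sub (analyticAt_id.neg.rexp.div_const)).continuousAt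
  have hβd : ∀ x ∈ Ioi (0 : ℝ), HasDerivAt β
      (binetIntegrand x - binetRemainder x / x - binetRemainder x / 2) x := by
    intro x hx
    have hx0 : (0 : ℝ) < x := hx
    have he := (hasDerivAt_neg x).exp
    have h := (((he.sub_const 1).div (hasDerivAt_id x) hx0.ne').neg).sub (he.div_const 4)
    refine (h.congr_of_eventuallyEq ?_).congr_deriv ?_
    · filter_upwards [Ioi_mem_nhds hx0] with y hy
      simp only [hβ, dslope_exp_neg_of_pos hy]
      rfl
    · rw [binetIntegrand_of_pos hx0, binetRemainder_of_pos hx0]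
      simp only [id]
      field_simp
      ring
  have hβl : Tendsto β atTop (𝓝 0) := by
    have t1 : Tendsto (fun x : ℝ => Real.exp (-x)) atTop (𝓝 0) := Real.tendsto_exp_neg_atTop_nhds_zero
    have t2 := ((t1.sub_const 1).div_atTop tendsto_id).neg.sub (t1.div_const 4)
    simp only [neg_zero, zero_div, sub_zero] at t2
    refine t2.congr' ?_
    filter_upwards [eventually_gt_atTop 0] with x hx
    simp only [hβ, dslope_exp_neg_of_pos hx]
    rfl
  have i2 : IntegrableOn (fun x => binetRemainder x / 2) (Ioi 0) := i1.div_const 2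
  have h := integral_Ioi_of_hasDerivAt_of_tendsto hβc.continuousWithinAt hβd
    ((integrableOn_binetIntegrand.sub i0).sub i2) hβl
  have h2 : ∫ x in Ioi (0 : ℝ), (binetIntegrand x - binetRemainder x / x - binetRemainder x / 2)
      = (∫ x in Ioi (0 : ℝ), binetIntegrand x) - (∫ x in Ioi (0 : ℝ), binetRemainder x / x)
        - ∫ x in Ioi (0 : ℝ), binetRemainder x / 2 := by
    rw [← integral_sub' integrableOn_binetIntegrand i0,
      ← integral_sub' (integrableOn_binetIntegrand.sub i0) i2]
    rfl
  rw [h2, integral_div, v0, v1] at h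
  simp only [hβ, dslope_exp_neg_zero] at h
  norm_num at h
  linarith

/-! ### The Mellin transform of f in the critical strip. -/

open Asymptotics Filter Topology in
lemma mellinConvergent_dslope_exp_neg {s : ℂ} (h0 : 0 < s.re) (h1 : s.re < 1) :
    MellinConvergent (fun x => ((dslope (fun y : ℝ => Real.exp (-y)) 0 x : ℝ) : ℂ)) s := by
  have hc : Continuous (dslope (fun y : ℝ => Real.exp (-y)) 0) :=
    continuous_iff_continuousAt.mpr fun x => (analyticAt_dslope_exp_neg x).continuousAt
  have hc' : Continuous fun x => ((dslope (fun y : ℝ => Real.exp (-y)) 0 x : ℝ) : ℂ) :=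
    Complex.continuous_ofReal.comp hc
  refine mellinConvergent_of_isBigO_rpow (a := 1) (b := 0)
    (hc'.locallyIntegrable.locallyIntegrableOn _) ?_ h1 ?_ h0
  · refine IsBigO.of_bound 1 ?_
    filter_upwards [eventually_gt_atTop 0] with x hx
    have he : Real.exp (-x) ≤ 1 := by simpa using hx.le
    have he0 := Real.exp_pos (-x)
    rw [Complex.norm_real, dslope_exp_neg_of_pos hx, Real.rpow_neg_one, norm_div,
      Real.norm_of_nonneg hx.le, norm_inv, Real.norm_of_nonneg hx.le, one_mul, ← one_div]
    gcongr
    rw [Real.norm_eq_abs, abs_le]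
    constructor <;> linarith
  · have h := (hc'.continuousAt (x := 0)).isBigO_one (F := ℝ)
    simp only [neg_zero, Real.rpow_zero]
    exact h.mono nhdsWithin_le_nhds

open MeasureTheory Set Filter Topology in
lemma mellin_dslope_exp_neg {s : ℂ} (h0 : 0 < s.re) (h1 : s.re < 1) :
    mellin (fun x => ((dslope (fun y : ℝ => Real.exp (-y)) 0 x : ℝ) : ℂ)) s
      = Complex.Gamma s / (s - 1) := by
  have hs0 : s ≠ 0 := fun h => by simp [h] at h0
  have hs1 : s - 1 ≠ 0 := fun h => by
    rw [sub_eq_zero] at h; simp [h] at h1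
  have hc : Continuous (dslope (fun y : ℝ => Real.exp (-y)) 0) :=
    continuous_iff_continuousAt.mpr fun x => (analyticAt_dslope_exp_neg x).continuousAt
  -- With φ(x) = (e⁻ˣ - 1)/x, the function (xˢ/s)φ vanishes at 0 and at ∞. Integrating its
  -- derivative gives (s - 1) times the transform of φ equal to Γ(s).
  have hG : Continuous fun x : ℝ => (x : ℂ) ^ s / s
      * ((dslope (fun y : ℝ => Real.exp (-y)) 0 x : ℝ) : ℂ) :=
    ((Complex.continuous_ofReal_cpow_const h0).div_const s).mul
      (Complex.continuous_ofReal.comp hc)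
  have c1 := (mellinConvergent_dslope_exp_neg h0 h1).const_smul ((s - 1) / s)
  have c2 := (hasMellin_exp_neg h0).1.const_smul (1 / s)
  have hc12 := hasMellin_sub c1 c2
  have hd : ∀ x ∈ Ioi (0 : ℝ), HasDerivAt (fun x : ℝ => (x : ℂ) ^ s / s
      * ((dslope (fun y : ℝ => Real.exp (-y)) 0 x : ℝ) : ℂ))
      ((x : ℂ) ^ (s - 1) • (((s - 1) / s) • ((dslope (fun y : ℝ => Real.exp (-y)) 0 x : ℝ) : ℂ)
        - (1 / s) • (Real.exp (-x) : ℂ))) x := by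
    intro x hx
    have hx0 : (0 : ℝ) < x := hx
    have hxc : (x : ℂ) ≠ 0 := by exact_mod_cast hx0.ne'
    have d1 := hasDerivAt_ofReal_cpow_const' hx0.ne' (r := s - 1) (by
      intro h; apply hs0; linear_combination h)
    rw [sub_add_cancel] at d1
    have d2 : HasDerivAt (dslope (fun y : ℝ => Real.exp (-y)) 0)
        (-Real.exp (-x) / x - (Real.exp (-x) - 1) / x ^ 2) x := by
      have he := (hasDerivAt_neg x).exp
      refine (((he.sub_const 1).div (hasDerivAt_id x) hx0.ne').congr_of_eventuallyEq
        ?_).congr_deriv ?_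
      · filter_upwards [Ioi_mem_nhds hx0] with y hy
        rw [dslope_exp_neg_of_pos hy]
        rfl
      · simp only [id]
        field_simp
    refine (d1.mul d2.ofReal_comp).congr_deriv ?_
    rw [dslope_exp_neg_of_pos hx0]
    have hcp : (x : ℂ) ^ s = (x : ℂ) ^ (s - 1) * x := by
      rw [Complex.cpow_sub _ _ hxc, Complex.cpow_one]; field_simp
    rw [hcp]
    push_cast
    simp only [smul_eq_mul]
    field_simp
    ring
  have hl : Tendsto (fun x : ℝ => (x : ℂ) ^ s / s
      * ((dslope (fun y : ℝ => Real.exp (-y)) 0 x : ℝ) : ℂ)) atTop (𝓝 0) := by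
    refine squeeze_zero_norm' (a := fun x : ℝ => x ^ (-(1 - s.re)) / ‖s‖) ?_ ?_
    · filter_upwards [eventually_gt_atTop 0] with x hx
      have he : Real.exp (-x) ≤ 1 := by simpa using hx.le
      have he0 := Real.exp_pos (-x)
      have hb : |(Real.exp (-x) - 1) / x| ≤ 1 / x := by
        rw [abs_div, abs_of_pos hx]
        gcongr
        rw [abs_le]
        constructor <;> linarith
      rw [norm_mul, norm_div, Complex.norm_cpow_eq_rpow_re_of_pos hx, Complex.norm_real,
        dslope_exp_neg_of_pos hx, Real.norm_eq_abs, neg_sub, Real.rpow_sub_one hx.ne']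
      calc x ^ s.re / ‖s‖ * |(Real.exp (-x) - 1) / x| ≤ x ^ s.re / ‖s‖ * (1 / x) := by gcongr
        _ = _ := by ring
    · simpa using (tendsto_rpow_neg_atTop (by linarith : 0 < 1 - s.re)).div_const ‖s‖
  have h := integral_Ioi_of_hasDerivAt_of_tendsto hG.continuousWithinAt hd hc12.1 hl
  have h2 := hc12.2
  rw [mellin, h, mellin_const_smul, mellin_const_smul, (hasMellin_exp_neg h0).2] at h2
  simp only [Complex.ofReal_zero, Complex.zero_cpow hs0, smul_eq_mul] at h2
  field_simp at h2
  rw [eq_div_iff hs1]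
  linear_combination -h2

lemma mellin_planckKernel {s : ℂ} (h0 : 0 < s.re) (h1 : s.re < 1) :
    mellin (fun x => (planckKernel x : ℂ)) s = Complex.Gamma s * riemannZeta s := by
  have c0 := mellinConvergent_binetRemainder (s := s) (by linarith)
  have c1 := mellinConvergent_dslope_exp_neg h0 h1
  have c2 := (hasMellin_exp_neg h0).1.const_smul (1 / 2 : ℂ)
  have e : (fun x => (planckKernel x : ℂ)) = fun x => (binetRemainder x : ℂ)
      + (((dslope (fun y : ℝ => Real.exp (-y)) 0 x : ℝ) : ℂ) + (1 / 2 : ℂ) • (Real.exp (-x) : ℂ)) := by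
    funext x
    rw [binetRemainder]
    push_cast
    simp only [smul_eq_mul]
    ring
  rw [e, (hasMellin_add c0 (hasMellin_add c1 c2).1).2, (hasMellin_add c1 c2).2,
    mellin_const_smul, (hasMellin_exp_neg h0).2, mellin_dslope_exp_neg h0 h1,
    mellin_binetRemainder_of_mem_strip h0 h1]
  simp only [smul_eq_mul]
  ring

/-! ### The kernel in the logarithmic variable as a Schwartz function. -/

/-- The function `e^{-(k + 1/2) u} f⁽ᵏ⁾(e^{-u})` for `f = planckKernel`. -/
noncomputable def logKernel (u : ℝ) (k : ℕ) : ℝ :=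
  Real.exp (-(k + 1 / 2) * u) * iteratedDeriv k planckKernel (Real.exp (-u))

lemma hasDerivAt_logKernel (k : ℕ) (u : ℝ) :
    HasDerivAt (fun u => logKernel u k)
      (-((k + 1 / 2) * logKernel u k + logKernel u (k + 1))) u := by
  have h1 := ((hasDerivAt_id u).const_mul (-((k : ℝ) + 1 / 2))).exp
  have h2 := (hasDerivAt_iteratedDeriv_planckKernel k (Real.exp (-u))).comp u
    (hasDerivAt_neg u).exp
  refine (h1.mul h2).congr_deriv ?_
  have e : Real.exp (-((k + 1 : ℕ) + 1 / 2) * u)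
      = Real.exp (-(k + 1 / 2) * u) * Real.exp (-u) := by
    rw [← Real.exp_add]; congr 1; push_cast; ring
  simp only [logKernel, e, Function.comp, id]
  ring

/-- `(-2)ᴹ` times the `M`-th derivative of `u ↦ logKernel u 0`. -/
noncomputable def logKernelSum (M : ℕ) (u : ℝ) : ℝ :=
  ∑ n ∈ Finset.range (M + 1), (M.choose n : ℝ) * 2 ^ n * stirlingSum n (logKernel u)

lemma hasDerivAt_stirlingSum_logKernel (n : ℕ) (u : ℝ) :
    HasDerivAt (fun u => stirlingSum n (logKernel u))
      (-(1 / 2 * stirlingSum n (logKernel u) + stirlingSum (n + 1) (logKernel u))) u := by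
  have h : HasDerivAt (fun u => stirlingSum n (logKernel u)) _ u :=
    HasDerivAt.fun_sum fun k _ => (hasDerivAt_logKernel k u).const_mul
      (Nat.stirlingSecond n k : ℝ)
  refine h.congr_deriv ?_
  rw [stirlingSum_succ, ← stirlingSum_const_mul, ← stirlingSum_add, stirlingSum,
    ← Finset.sum_neg_distrib]
  exact Finset.sum_congr rfl fun k _ => by ring

/-- Pascal's rule expresses (1 + 2θ)^{M+1} = (1 + 2θ)(1 + 2θ)ᴹ. -/
lemma hasDerivAt_logKernelSum (M : ℕ) (u : ℝ) :
    HasDerivAt (logKernelSum M) (-1 / 2 * logKernelSum (M + 1) u) u := by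
  have h : HasDerivAt (logKernelSum M) _ u :=
    HasDerivAt.fun_sum fun n _ => (hasDerivAt_stirlingSum_logKernel n u).const_mul
      ((M.choose n : ℝ) * 2 ^ n)
  refine h.congr_deriv ?_
  have hp : logKernelSum (M + 1) u
      = (∑ n ∈ Finset.range (M + 1), (M.choose n : ℝ) * 2 ^ (n + 1)
          * stirlingSum (n + 1) (logKernel u))
        + ∑ n ∈ Finset.range (M + 1), (M.choose n : ℝ) * 2 ^ n * stirlingSum n (logKernel u) := by
    rw [logKernelSum, Finset.sum_range_succ']
    simp only [Nat.choose_succ_succ, Nat.cast_add, add_mul, Finset.sum_add_distrib]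
    rw [add_assoc]
    congr 1
    have h := Finset.sum_range_succ' (fun n => (M.choose n : ℝ) * 2 ^ n
      * stirlingSum n (logKernel u)) (M + 1)
    rw [Finset.sum_range_succ, Nat.choose_succ_self, Nat.cast_zero, zero_mul, zero_mul,
      add_zero] at h
    simpa using h.symm
  rw [hp, ← Finset.sum_add_distrib, Finset.mul_sum]
  exact Finset.sum_congr rfl fun n _ => by ring

lemma logKernelSum_zero (u : ℝ) : logKernelSum 0 u = logKernel u 0 := by
  simp [logKernelSum, stirlingSum_zero]

lemma iteratedDeriv_logKernel (M : ℕ) :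
    iteratedDeriv M (fun u => (logKernel u 0 : ℂ))
      = fun u => (((-1 / 2) ^ M * logKernelSum M u : ℝ) : ℂ) := by
  induction M with
  | zero => funext u; simp [logKernelSum_zero]
  | succ M ih =>
    rw [iteratedDeriv_succ, ih]
    funext u
    rw [((hasDerivAt_logKernelSum M u).const_mul _).ofReal_comp.deriv]
    congr 1
    ring

/-- With x = e⁻ᵘ the bound xᵏ f⁽ᵏ⁾ = O(1/(1+x)) gives e^{-u/2}/(1 + e⁻ᵘ) ≤ e^{-|u|/2}: decay at both
ends. -/
lemma exists_abs_logKernel_le (k : ℕ) :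
    ∃ C : ℝ, 0 ≤ C ∧ ∀ u, |logKernel u k| ≤ C * Real.exp (-|u| / 2) := by
  obtain ⟨C, hC0, hC⟩ := exists_abs_pow_mul_iteratedDeriv_le k
  refine ⟨C, hC0, fun u => ?_⟩
  have e : logKernel u k = Real.exp (-u / 2)
      * (Real.exp (-u) ^ k * iteratedDeriv k planckKernel (Real.exp (-u))) := by
    rw [logKernel, ← mul_assoc, ← Real.exp_nat_mul, ← Real.exp_add]
    congr 2
    ring
  rw [e, abs_mul, abs_of_pos (Real.exp_pos _)]
  have h1 := hC _ (Real.exp_pos (-u))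
  have h2 : Real.exp (-u / 2) ≤ Real.exp (-|u| / 2) * (1 + Real.exp (-u)) := by
    rcases le_total 0 u with h | h
    · rw [abs_of_nonneg h]
      have := Real.exp_pos (-u)
      have := Real.exp_pos (-u / 2)
      nlinarith
    · rw [abs_of_nonpos h, neg_neg, mul_add, ← Real.exp_add, mul_one]
      have h3 : u / 2 + -u = -u / 2 := by ring
      rw [h3]
      have := Real.exp_pos (u / 2)
      linarith
  calc Real.exp (-u / 2) * |Real.exp (-u) ^ k * iteratedDeriv k planckKernel (Real.exp (-u))|
      ≤ (Real.exp (-|u| / 2) * (1 + Real.exp (-u))) * (C / (1 + Real.exp (-u))) := by gcongr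
    _ = C * Real.exp (-|u| / 2) := by
      have : 1 + Real.exp (-u) ≠ 0 := by positivity
      field_simp

lemma exists_abs_logKernelSum_le (M : ℕ) :
    ∃ C : ℝ, 0 ≤ C ∧ ∀ u, |logKernelSum M u| ≤ C * Real.exp (-|u| / 2) := by
  choose C hC0 hC using exists_abs_logKernel_le
  refine ⟨∑ n ∈ Finset.range (M + 1), (M.choose n : ℝ) * 2 ^ n * stirlingSum n C, ?_, fun u => ?_⟩
  · refine Finset.sum_nonneg fun n _ => mul_nonneg (by positivity) ?_
    exact Finset.sum_nonneg fun k _ => mul_nonneg (by positivity) (hC0 k)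
  · rw [logKernelSum, Finset.sum_mul]
    refine (Finset.abs_sum_le_sum_abs _ _).trans (Finset.sum_le_sum fun n _ => ?_)
    rw [abs_mul, abs_of_nonneg (by positivity), mul_assoc _ (stirlingSum n C)]
    refine mul_le_mul_of_nonneg_left ?_ (by positivity)
    rw [stirlingSum, stirlingSum, Finset.sum_mul]
    refine (Finset.abs_sum_le_sum_abs _ _).trans (Finset.sum_le_sum fun k _ => ?_)
    rw [abs_mul, abs_of_nonneg (by positivity), mul_assoc]
    exact mul_le_mul_of_nonneg_left (hC k u) (by positivity)

lemma pow_abs_mul_exp_le (p : ℕ) (u : ℝ) :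
    |u| ^ p * Real.exp (-|u| / 2) ≤ 2 ^ p * (p.factorial : ℝ) := by
  have h := Real.pow_div_factorial_le_exp (|u| / 2) (by positivity) p
  rw [div_le_iff₀ (by positivity), div_pow, div_le_iff₀ (by positivity)] at h
  rw [neg_div, Real.exp_neg, ← div_eq_mul_inv, div_le_iff₀ (Real.exp_pos _)]
  linarith

open scoped ContDiff in
lemma contDiff_logKernel (k : ℕ) : ContDiff ℝ ∞ (fun u => logKernel u k) := by
  have h : ContDiff ℝ ∞ (iteratedDeriv k planckKernel) := by
    rw [iteratedDeriv_eq_iterate]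
    exact AnalyticOnNhd.contDiff fun x _ => (analyticAt_planckKernel x).iterated_deriv k
  unfold logKernel
  fun_prop

open scoped SchwartzMap in
/-- `u ↦ e^{-u/2} f(e^{-u})` as a Schwartz function, for `f = planckKernel`. -/
noncomputable def logKernelSchwartz : 𝓢(ℝ, ℂ) where
  toFun u := (logKernel u 0 : ℂ)
  smooth' := Complex.ofRealCLM.contDiff.comp (contDiff_logKernel 0)
  decay' p n := by
    obtain ⟨C, hC0, hC⟩ := exists_abs_logKernelSum_le n
    refine ⟨C * (2 ^ p * (p.factorial : ℝ)), fun u => ?_⟩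
    rw [norm_iteratedFDeriv_eq_norm_iteratedDeriv, iteratedDeriv_logKernel, Complex.norm_real,
      norm_mul, Real.norm_eq_abs u, norm_pow]
    have h1 : ‖(-1 / 2 : ℝ)‖ ^ n ≤ 1 := pow_le_one₀ (norm_nonneg _) (by norm_num)
    have h2 := hC u
    rw [← Real.norm_eq_abs (logKernelSum n u)] at h2
    calc |u| ^ p * (‖(-1 / 2 : ℝ)‖ ^ n * ‖logKernelSum n u‖)
        ≤ |u| ^ p * (1 * (C * Real.exp (-|u| / 2))) := by gcongr
      _ = C * (|u| ^ p * Real.exp (-|u| / 2)) := by ring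
      _ ≤ _ := mul_le_mul_of_nonneg_left (pow_abs_mul_exp_le p u) hC0

lemma logKernelSchwartz_apply (u : ℝ) : logKernelSchwartz u = (logKernel u 0 : ℂ) := rfl

/-! ### Fourier transform, Plancherel and the moments. -/

open scoped SchwartzMap FourierTransform in
lemma iterate_derivCLM_apply (G : 𝓢(ℝ, ℂ)) (n : ℕ) (x : ℝ) :
    ((SchwartzMap.derivCLM ℂ ℂ)^[n] G) x = iteratedDeriv n G x := by
  induction n generalizing x with
  | zero => simp
  | succ n ih =>
    rw [Function.iterate_succ_apply', SchwartzMap.derivCLM_apply, iteratedDeriv_succ]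
    congr 1
    exact funext ih

open scoped SchwartzMap FourierTransform in
lemma fourier_iterate_derivCLM_apply (G : 𝓢(ℝ, ℂ)) (n : ℕ) (x : ℝ) :
    𝓕 ((SchwartzMap.derivCLM ℂ ℂ)^[n] G) x = (2 * Real.pi * Complex.I * x) ^ n * 𝓕 G x := by
  induction n with
  | zero => simp
  | succ n ih =>
    rw [Function.iterate_succ_apply', SchwartzMap.fourier_coe]
    set H := (SchwartzMap.derivCLM ℂ ℂ)^[n] G
    have e : (SchwartzMap.derivCLM ℂ ℂ H : ℝ → ℂ) = deriv H :=
      funext fun y => SchwartzMap.derivCLM_apply ℂ H y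
    have hi : MeasureTheory.Integrable (deriv H) := by
      rw [← e]; exact SchwartzMap.integrable _
    rw [e, Real.fourier_deriv H.integrable H.differentiable hi]
    simp only [smul_eq_mul]
    rw [← SchwartzMap.fourier_coe, ih, pow_succ]
    ring

open scoped FourierTransform in
lemma gammaZetaSq_eq (t : ℝ) :
    gammaZetaSq t = ‖𝓕 logKernelSchwartz (t / (2 * Real.pi))‖ ^ 2 := by
  have hre : (1 / 2 + Complex.I * (t : ℂ)).re = 1 / 2 := by simp
  have him : (1 / 2 + Complex.I * (t : ℂ)).im = t := by simp
  have hf : (fun u : ℝ => Real.exp (-(1 / 2) * u) • (planckKernel (Real.exp (-u)) : ℂ))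
      = logKernelSchwartz := by
    funext u
    rw [logKernelSchwartz_apply, logKernel, Complex.real_smul, iteratedDeriv_zero]
    push_cast
    simp
  rw [gammaZetaSq, ← mellin_planckKernel (by rw [hre]; norm_num) (by rw [hre]; norm_num),
    mellin_eq_fourier, hre, him, SchwartzMap.fourier_coe, hf]

open scoped FourierTransform in
lemma integrable_pow_mul_norm_fourier_sq (N : ℕ) :
    MeasureTheory.Integrable fun ξ : ℝ =>
      (2 * Real.pi * ξ) ^ (2 * N) * ‖𝓕 logKernelSchwartz ξ‖ ^ 2 := by
  -- The integrand is |·|² of the Fourier transform of the N-th derivative, again a Schwartz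
  -- function and so in L².
  have h := ((𝓕 ((SchwartzMap.derivCLM ℂ ℂ)^[N] logKernelSchwartz)).memLp 2).integrable_norm_pow
    (by norm_num)
  refine h.congr (Filter.Eventually.of_forall fun ξ => ?_)
  simp only
  rw [fourier_iterate_derivCLM_apply, norm_mul, mul_pow, norm_pow, ← pow_mul, mul_comm N 2]
  congr 1
  have : ‖2 * (Real.pi : ℂ) * Complex.I * ξ‖ = |2 * Real.pi * ξ| := by
    simp [abs_mul, abs_of_pos Real.pi_pos]
  rw [this, pow_mul, sq_abs, pow_mul]

lemma integrable_pow_mul_gammaZetaSq (N : ℕ) :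
    MeasureTheory.Integrable fun t : ℝ => t ^ (2 * N) * gammaZetaSq t := by
  have h := (integrable_pow_mul_norm_fourier_sq N).comp_div (R := 2 * Real.pi) (by positivity)
  refine h.congr (Filter.Eventually.of_forall fun t => ?_)
  simp only
  rw [gammaZetaSq_eq, mul_div_cancel₀ _ (by positivity)]

open scoped FourierTransform in
lemma integral_pow_mul_gammaZetaSq (N : ℕ) :
    ∫ t : ℝ, t ^ (2 * N) * gammaZetaSq t
      = 2 * Real.pi * ∫ ξ : ℝ, (2 * Real.pi * ξ) ^ (2 * N) * ‖𝓕 logKernelSchwartz ξ‖ ^ 2 := by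
  have h := MeasureTheory.Measure.integral_comp_div (fun ξ : ℝ =>
    (2 * Real.pi * ξ) ^ (2 * N) * ‖𝓕 logKernelSchwartz ξ‖ ^ 2) (2 * Real.pi)
  rw [abs_of_pos (by positivity), smul_eq_mul] at h
  rw [← h]
  refine MeasureTheory.integral_congr_ae (Filter.Eventually.of_forall fun t => ?_)
  simp only
  rw [gammaZetaSq_eq, mul_div_cancel₀ _ (by positivity)]

open scoped FourierTransform in
lemma integral_pow_mul_norm_fourier_sq (N : ℕ) :
    (-4 : ℝ) ^ N * ∫ ξ : ℝ, (2 * Real.pi * ξ) ^ (2 * N) * ‖𝓕 logKernelSchwartz ξ‖ ^ 2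
      = ∫ u : ℝ, logKernel u 0 * logKernelSum (2 * N) u := by
  have h := SchwartzMap.integral_inner_fourier_fourier logKernelSchwartz
    ((SchwartzMap.derivCLM ℂ ℂ)^[2 * N] logKernelSchwartz)
  have e1 : ∀ ξ : ℝ, inner ℂ (𝓕 logKernelSchwartz ξ)
      (𝓕 ((SchwartzMap.derivCLM ℂ ℂ)^[2 * N] logKernelSchwartz) ξ)
      = (((-1) ^ N * ((2 * Real.pi * ξ) ^ (2 * N) * ‖𝓕 logKernelSchwartz ξ‖ ^ 2) : ℝ) : ℂ) := by
    intro ξ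
    rw [fourier_iterate_derivCLM_apply, RCLike.inner_apply, mul_assoc, Complex.mul_conj,
      Complex.normSq_eq_norm_sq]
    push_cast
    rw [show (2 * (Real.pi : ℂ) * Complex.I * ξ) = Complex.I * (2 * Real.pi * ξ) by ring, mul_pow,
      pow_mul Complex.I, Complex.I_sq]
    ring
  have e2 : ∀ u : ℝ, inner ℂ (logKernelSchwartz u)
      (((SchwartzMap.derivCLM ℂ ℂ)^[2 * N] logKernelSchwartz) u)
      = (((1 / 4) ^ N * (logKernel u 0 * logKernelSum (2 * N) u) : ℝ) : ℂ) := by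
    intro u
    have hi : iteratedDeriv (2 * N) logKernelSchwartz u
        = (((-1 / 2) ^ (2 * N) * logKernelSum (2 * N) u : ℝ) : ℂ) :=
      congrFun (iteratedDeriv_logKernel (2 * N)) u
    rw [iterate_derivCLM_apply, hi, RCLike.inner_apply, logKernelSchwartz_apply, Complex.conj_ofReal,
      ← Complex.ofReal_mul, pow_mul]
    congr 1
    norm_num
    ring
  simp only [e1, e2] at h
  rw [integral_complex_ofReal, integral_complex_ofReal, Complex.ofReal_inj,
    MeasureTheory.integral_const_mul, MeasureTheory.integral_const_mul] at h
  rw [show (-4 : ℝ) ^ N = 4 ^ N * (-1) ^ N by rw [← mul_pow]; norm_num, mul_assoc, h, ← mul_assoc,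
    ← mul_pow]
  norm_num

open scoped FourierTransform in
lemma integral_logKernel_mul (k : ℕ) :
    ∫ u : ℝ, logKernel u 0 * logKernel u k
      = ∫ x in Set.Ioi (0 : ℝ), x ^ k * (planckKernel x * iteratedDeriv k planckKernel x) := by
  -- At s = 1 the frequency is 0, and the Mellin–Fourier identity is just the substitution x = e⁻ᵘ.
  have h := mellin_eq_fourier (fun x : ℝ =>
    ((x ^ k * (planckKernel x * iteratedDeriv k planckKernel x) : ℝ) : ℂ)) (s := 1)
  simp only [mellin, sub_self, Complex.cpow_zero, one_smul, Complex.one_im, zero_div,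
    Complex.one_re] at h
  rw [integral_complex_ofReal, Real.fourier_eq'] at h
  simp only [inner_zero_right, mul_zero, Complex.ofReal_zero, zero_mul, Complex.exp_zero,
    one_smul, Complex.real_smul, ← Complex.ofReal_mul] at h
  rw [integral_complex_ofReal, Complex.ofReal_inj] at h
  rw [h]
  refine MeasureTheory.integral_congr_ae (Filter.Eventually.of_forall fun u => ?_)
  have e : Real.exp (-1 * u) * Real.exp (-u) ^ k
      = Real.exp (-((0 : ℕ) + 1 / 2) * u) * Real.exp (-(k + 1 / 2) * u) := by
    rw [← Real.exp_nat_mul, ← Real.exp_add, ← Real.exp_add]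
    congr 1
    push_cast
    ring
  simp only [logKernel, iteratedDeriv_zero]
  rw [← mul_assoc (Real.exp (-1 * u)), e]
  ring

lemma integrable_logKernel_mul (k : ℕ) :
    MeasureTheory.Integrable fun u : ℝ => logKernel u 0 * logKernel u k := by
  obtain ⟨C, hC0, hC⟩ := exists_abs_logKernel_le k
  have h0 : MeasureTheory.Integrable fun u : ℝ => logKernel u 0 := by
    simpa [logKernelSchwartz_apply] using (logKernelSchwartz.integrable).re
  refine h0.mul_bdd (c := C) (contDiff_logKernel k).continuous.aestronglyMeasurable
    (Filter.Eventually.of_forall fun u => ?_)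
  rw [Real.norm_eq_abs]
  refine (hC u).trans (mul_le_of_le_one_right hC0 ?_)
  rw [Real.exp_le_one_iff]
  have := abs_nonneg u
  linarith

lemma integral_logKernel_mul_logKernelSum (M : ℕ) :
    ∫ u : ℝ, logKernel u 0 * logKernelSum M u
      = ∑ n ∈ Finset.range (M + 1), (M.choose n : ℝ) * 2 ^ n * stirlingSum n
        (fun k => ∫ x in Set.Ioi (0 : ℝ),
          x ^ k * (planckKernel x * iteratedDeriv k planckKernel x)) := by
  simp only [logKernelSum, stirlingSum, Finset.mul_sum]
  have hi : ∀ n k : ℕ, MeasureTheory.Integrable fun u : ℝ => logKernel u 0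
      * ((M.choose n : ℝ) * 2 ^ n * ((Nat.stirlingSecond n k : ℝ) * logKernel u k)) := by
    intro n k
    refine ((integrable_logKernel_mul k).const_mul
      ((M.choose n : ℝ) * 2 ^ n * (Nat.stirlingSecond n k : ℝ))).congr
      (Filter.Eventually.of_forall fun u => ?_)
    simp only
    ring
  rw [MeasureTheory.integral_finsetSum _ fun n _ =>
    MeasureTheory.integrable_finsetSum _ fun k _ => hi n k]
  refine Finset.sum_congr rfl fun n _ => ?_
  rw [MeasureTheory.integral_finsetSum _ fun k _ => hi n k]
  refine Finset.sum_congr rfl fun k _ => ?_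
  rw [← integral_logKernel_mul, ← mul_assoc, ← MeasureTheory.integral_const_mul]
  refine MeasureTheory.integral_congr_ae (Filter.Eventually.of_forall fun u => ?_)
  simp only
  ring

/-! ### The moment formula, over ℝ and then with the complex zeta function. -/

lemma moment_eq (N : ℕ) :
    (-4 : ℝ) ^ N / (2 * Real.pi) * ∫ t : ℝ, t ^ (2 * N) * gammaZetaSq t
      = Real.log (2 * Real.pi) - Real.eulerMascheroniConstant - 4 * (N : ℝ)
        + ((4 : ℝ) ^ N / 2 - 1) * ((bernoulli (2 * N) : ℚ) : ℝ)
        + ∑ j ∈ Finset.Icc 2 (2 * N), (momentT (2 * N) j : ℝ)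
          * (zetaReal j * ((bernoulli j : ℚ) : ℝ) / j) := by
  have h1 : (-4 : ℝ) ^ N / (2 * Real.pi) * ∫ t : ℝ, t ^ (2 * N) * gammaZetaSq t
      = ∫ u : ℝ, logKernel u 0 * logKernelSum (2 * N) u := by
    rw [integral_pow_mul_gammaZetaSq, ← integral_pow_mul_norm_fourier_sq]
    have : Real.pi ≠ 0 := Real.pi_ne_zero
    field_simp
  rw [h1, integral_logKernel_mul_logKernelSum, sum_choose_stirlingSum_eq N _ _ _
    integral_planckKernel_sq (fun k hk => integral_pow_mul_planckKernel_mul hk),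
    integral_binetIntegrand]
  ring

theorem theorem1 (N : ℕ) :
    MeasureTheory.Integrable (fun t : ℝ => t ^ (2 * N) * gammaZetaSq t) MeasureTheory.volume ∧
    (((-4 : ℝ) ^ N / (2 * Real.pi) * ∫ t : ℝ, t ^ (2 * N) * gammaZetaSq t : ℝ) : ℂ) =
      ((Real.log (2 * Real.pi) - Real.eulerMascheroniConstant - 4 * (N : ℝ)
        + ((4 : ℝ) ^ N / 2 - 1) * ((bernoulli (2 * N) : ℚ) : ℝ) : ℝ) : ℂ)
      + ∑ j ∈ Finset.Icc 2 (2 * N),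
          (momentT (2 * N) j : ℂ) * (riemannZeta (j : ℂ) * ((bernoulli j : ℚ) : ℂ) / (j : ℂ)) := by
  refine ⟨integrable_pow_mul_gammaZetaSq N, ?_⟩
  rw [moment_eq, Complex.ofReal_add, Complex.ofReal_sum]
  congr 1
  refine Finset.sum_congr rfl fun j hj => ?_
  rw [← ofReal_zetaReal (Finset.mem_Icc.mp hj).1]
  push_cast
  rfl
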